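/- For a Dirichlet character $\chi$ mod $N$ let $\tau(\chi)=\sum_{b=1}^{N}\chi(b)e^{2\pi i b/N}$ be its Gauss sum, and let $\chi_0$ denote the principal character mod $N$. Let $\mathcal{D}_{\pm}(N)$ be the set of primitive Dirichlet characters $\chi$ mod $N$ with $\chi(-1)=\pm1$, and let $\mathcal{I}_{\pm}(N)$ be the set of imprimitive Dirichlet characters $\chi\neq\chi_0$ mod $N$ with $\chi(-1)=\pm1$. For $x\in\mathbb{R}_{>0}$ let $\lceil x\rceil^{\mathfrak p}$ be the smallest prime that is at least $x$. For $\delta\in(0,1)$, $y\in\mathbb{R}_{>0}$ and real $X>0$ put \[ \widetilde{Q}_{\pm}(y,X,\delta)=\frac{1}{X^{\delta}}\sum_{\substack{N\in[X,X+X^{\delta}]\\ N\not\equiv 2\bmod 4}}\ \sum_{\chi\in\mathcal{D}_{\pm}(N)}\frac{\chi(\lceil yX\rceil^{\mathfrak p})}{\tau(\chi)}, \] \[ \widetilde{E}_{\pm}(y,X,\delta)=\frac{1}{X^{\delta}}\sum_{\substack{N\in[X,X+X^{\delta}]\\ N\not\equiv 2\bmod 4}}\frac1N\sum_{\chi\in\mathcal{I}_{\pm}(N)}\tau(\overline{\chi})\,\chi(\lceil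 yX\rceil^{\mathfrak p}), \] where $N$ runs over integers, and \[ \widetilde{T}_{\pm}(y,X,\delta)=\widetilde{Q}_{\pm}(y,X,\delta)\pm\widetilde{E}_{\pm}(y,X,\delta). \] Then (unconditionally) for every $\delta\in(0,1)$ and every $y\in\mathbb{R}_{>0}$, \[ \lim_{X\to\infty}\widetilde{T}_{+}(y,X,\delta)=\frac{5}{\pi^2}\cos(2\pi y),\qquad \lim_{X\to\infty}\widetilde{T}_{-}(y,X,\delta)=-i\,\frac{5}{\pi^2}\sin(2\pi y). \] -/

import Mathlib

open Filter Topology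

noncomputable section

namespace Murmuration

/-- The Gauss sum `τ(χ) = ∑_{b=1}^{N} χ(b) e^{2πib/N}` of a Dirichlet character mod `N`. -/
def tau {N : ℕ} (χ : DirichletCharacter ℂ N) : ℂ :=
  ∑ b ∈ Finset.Icc 1 N, χ (b : ZMod N) * Complex.exp (2 * Real.pi * Complex.I * b / N)

/-- For `N ≥ 1`, `tau` is Mathlib's Gauss sum with respect to the standard additive character. -/
theorem tau_eq_gaussSum {N : ℕ} [NeZero N] (χ : DirichletCharacter ℂ N) :
    tau χ = gaussSum χ (ZMod.stdAddChar (N := N)) := by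
  rw [tau, gaussSum]
  refine Finset.sum_bij (fun b _ => (b : ZMod N)) (fun _ _ => Finset.mem_univ _) ?_ ?_ ?_
  · intro a ha b hb h
    rw [Finset.mem_Icc] at ha hb
    have h' := (ZMod.natCast_eq_natCast_iff _ _ _).1 h
    rcases le_total a b with hab | hab
    · have := Nat.eq_zero_of_dvd_of_lt ((Nat.modEq_iff_dvd' hab).1 h') (by omega)
      omega
    · have := Nat.eq_zero_of_dvd_of_lt ((Nat.modEq_iff_dvd' hab).1 h'.symm) (by omega)
      omega
  · intro z _
    by_cases hz : z.val = 0
    · refine ⟨N, Finset.mem_Icc.2 ⟨Nat.one_le_iff_ne_zero.2 (NeZero.ne N), le_rfl⟩, ?_⟩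
      rw [ZMod.natCast_self, (ZMod.val_eq_zero z).1 hz]
    · exact ⟨z.val, Finset.mem_Icc.2 ⟨Nat.one_le_iff_ne_zero.2 hz, z.val_lt.le⟩,
        ZMod.natCast_zmod_val z⟩
  · intro b _
    have := ZMod.stdAddChar_coe (N := N) (b : ℤ)
    push_cast at this
    rw [this]

open Classical in
/-- `D_ε(N)`: the primitive Dirichlet characters `χ` mod `N` with `χ(-1) = ε`, for a sign `ε`. -/
def primitiveChars (ε : ℤˣ) (N : ℕ) : Finset (DirichletCharacter ℂ N) :=
  Finset.univ.filter fun χ => χ.IsPrimitive ∧ χ (-1) = ((ε : ℤ) : ℂ)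

open Classical in
/-- `I_ε(N)`: the imprimitive, non-principal Dirichlet characters `χ` mod `N` with
`χ(-1) = ε`, for a sign `ε`. -/
def imprimitiveChars (ε : ℤˣ) (N : ℕ) : Finset (DirichletCharacter ℂ N) :=
  Finset.univ.filter fun χ => ¬ χ.IsPrimitive ∧ χ ≠ 1 ∧ χ (-1) = ((ε : ℤ) : ℂ)

/-- The smallest prime that is at least `x`. -/
def primeCeil (x : ℝ) : ℕ := sInf {p : ℕ | p.Prime ∧ x ≤ p}

/-- The integers `N ∈ [X, X + X^δ]` with `N ≢ 2 mod 4` (for `X > 0`). -/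
def shortConductors (X δ : ℝ) : Finset ℕ :=
  (Finset.Icc ⌈X⌉₊ ⌊X + X ^ δ⌋₊).filter fun N => ¬ N ≡ 2 [MOD 4]

/-- The average over primitive characters,
`X^{-δ} ∑_N ∑_{χ ∈ D_ε(N)} χ(⌈yX⌉^𝔭) / τ(χ)`. -/
def Qtilde (ε : ℤˣ) (y X δ : ℝ) : ℂ :=
  1 / ((X ^ δ : ℝ) : ℂ) * ∑ N ∈ shortConductors X δ, ∑ χ ∈ primitiveChars ε N,
    χ (primeCeil (y * X) : ZMod N) / tau χ

/-- The average over imprimitive characters,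
`X^{-δ} ∑_N N⁻¹ ∑_{χ ∈ I_ε(N)} τ(χ̄) χ(⌈yX⌉^𝔭)`. -/
def Etilde (ε : ℤˣ) (y X δ : ℝ) : ℂ :=
  1 / ((X ^ δ : ℝ) : ℂ) * ∑ N ∈ shortConductors X δ, 1 / (N : ℂ) *
    ∑ χ ∈ imprimitiveChars ε N, tau (star χ) * χ (primeCeil (y * X) : ZMod N)

/-- `T̃_± = Q̃_± ± Ẽ_±`, the sign being `ε`. -/
def Ttilde (ε : ℤˣ) (y X δ : ℝ) : ℂ :=
  Qtilde ε y X δ + ((ε : ℤ) : ℂ) * Etilde ε y X δ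

end Murmuration

end

noncomputable section

namespace Murmuration

open ArithmeticFunction (vonMangoldt moebius)

/-! For primitive χ of parity ε one has 1/τ(χ) = ε τ(χ̄)/N. So the primitive and imprimitive terms
of one modulus N merge into (ε/N) ∑ τ(χ̄)χ(p), over all non-principal χ of parity ε
(`modulusTerm_eq`). Opening the Gauss sums and using orthogonality leaves only the residues b = ±p,
which gives (φ(N)/N) `wave ε (p/N)`. The errors are O(1/N) from the principal character and O(1)
when p divides N (`norm_modulusTerm_sub_le`).

It remains to average over N. Since N/X → 1 uniformly (as δ < 1) and the prime p is asymptotic to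
yX, p/N → y and the wave becomes a constant factor. The mean of φ(N)/N over N ≢ 2 mod 4, normalised
by X^δ, is 5/π² (`tendsto_average_totient_div`): expand φ(N)/N = ∑ μ(d)/d and count multiples of d,
with a total error O(log X) against X^δ.

That p ~ yX requires a prime in [x, (1+ε)x] for large x (`eventually_exists_prime_mem_Icc`). This
follows by a Wiener–Ikehara style argument. The series of Λ − 1 is continuous up to Re s = 1, so by
Riemann–Lebesgue the sum of Λ(n)/n against a Fejér kernel centred at log n = x is eventually bounded
below by a fixed constant. A window free of primes would leave only the kernel's tails, of size
O(1/T), and the higher prime powers, which contribute o(1). -/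

/-! ### The Fejér kernel -/

/-- One half of the Fourier transform of the triangle function supported on `[-T, T]`. -/
def fejer (T u : ℝ) : ℝ := ∫ t in (0 : ℝ)..T, (1 - t / T) * Real.cos (t * u)

theorem fejer_eq {T u : ℝ} (hT : 0 < T) (hu : u ≠ 0) :
    fejer T u = (1 - Real.cos (T * u)) / (T * u ^ 2) := by
  have h : ∀ t ∈ Set.uIcc 0 T, HasDerivAt
      (fun t => (1 - t / T) * (Real.sin (t * u) / u) - Real.cos (t * u) / (T * u ^ 2))
      ((1 - t / T) * Real.cos (t * u)) t := by
    intro t _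
    have h1 : HasDerivAt (fun t : ℝ => 1 - t / T) (-(1 / T)) t := by
      simpa using ((hasDerivAt_id t).div_const T).const_sub 1
    have h0 : HasDerivAt (fun t : ℝ => t * u) u t := by
      simpa using (hasDerivAt_id t).mul_const u
    have h2 := h0.sin.div_const u
    have h3 := h0.cos.div_const (T * u ^ 2)
    refine ((h1.mul h2).sub h3).congr_deriv ?_
    field_simp
    ring
  rw [fejer, intervalIntegral.integral_eq_sub_of_hasDerivAt h
    (Continuous.intervalIntegrable (by fun_prop) _ _)]
  field_simp
  simp
  ring

theorem fejer_zero {T : ℝ} (hT : 0 < T) : fejer T 0 = T / 2 := by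
  have h : ∀ t ∈ Set.uIcc 0 T, HasDerivAt (fun t => t - t ^ 2 / (2 * T)) (1 - t / T) t := by
    intro t _
    refine ((hasDerivAt_id t).sub ((hasDerivAt_pow 2 t).div_const (2 * T))).congr_deriv ?_
    field_simp
    simp
    ring
  simp only [fejer, mul_zero, Real.cos_zero, mul_one]
  rw [intervalIntegral.integral_eq_sub_of_hasDerivAt h
    (Continuous.intervalIntegrable (by fun_prop) _ _)]
  field_simp
  ring

theorem fejer_nonneg {T : ℝ} (hT : 0 < T) (u : ℝ) : 0 ≤ fejer T u := by
  rcases eq_or_ne u 0 with rfl | hu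
  · rw [fejer_zero hT]; positivity
  · rw [fejer_eq hT hu]
    have := Real.cos_le_one (T * u)
    exact div_nonneg (by linarith) (by positivity)

theorem fejer_le {T : ℝ} (hT : 0 < T) (u : ℝ) : fejer T u ≤ T / 2 := by
  rcases eq_or_ne u 0 with rfl | hu
  · rw [fejer_zero hT]
  · rw [fejer_eq hT hu, div_le_iff₀ (by positivity)]
    have := Real.one_sub_sq_div_two_le_cos (x := T * u)
    nlinarith

theorem sq_mul_fejer_le {T : ℝ} (hT : 0 < T) (u : ℝ) : u ^ 2 * fejer T u ≤ 2 / T := by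
  rcases eq_or_ne u 0 with rfl | hu
  · simp; positivity
  · rw [fejer_eq hT hu]
    have h : u ^ 2 * ((1 - Real.cos (T * u)) / (T * u ^ 2)) = (1 - Real.cos (T * u)) / T := by
      field_simp
    rw [h]
    have := Real.neg_one_le_cos (T * u)
    gcongr
    linarith

/-- Sum of the peak bound and the quadratic decay; the resulting weight 1/(1+u²) is the one
controlled by `exists_sum_vonMangoldt_div_le`. -/
theorem fejer_le_div {T : ℝ} (hT : 0 < T) (u : ℝ) :
    fejer T u ≤ (T / 2 + 2 / T) / (1 + u ^ 2) := by
  rw [le_div_iff₀ (by positivity)]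
  linarith [fejer_le hT u, sq_mul_fejer_le hT u]

/-- On this range cos(tu) ≥ 1/2, so the kernel keeps at least half of its value T/2 at the origin.
-/
theorem le_fejer {T u : ℝ} (hT : 0 < T) (hu : |T * u| ≤ 1) : T / 4 ≤ fejer T u := by
  have h : ∫ t in (0 : ℝ)..T, (1 / 2) * ((1 - t / T) * Real.cos (t * 0)) ≤ fejer T u := by
    refine intervalIntegral.integral_mono_on hT.le
      (Continuous.intervalIntegrable (by fun_prop) _ _)
      (Continuous.intervalIntegrable (by fun_prop) _ _) fun t ht => ?_
    have h1 : 0 ≤ 1 - t / T := by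
      rw [sub_nonneg, div_le_one hT]; exact ht.2
    have h2 : (t * u) ^ 2 ≤ 1 := by
      rw [sq_le_one_iff_abs_le_one]
      refine le_trans ?_ hu
      rw [abs_mul, abs_mul, abs_of_nonneg ht.1, abs_of_pos hT]
      exact mul_le_mul_of_nonneg_right ht.2 (abs_nonneg _)
    have h3 := Real.one_sub_sq_div_two_le_cos (x := t * u)
    simp only [mul_zero, Real.cos_zero, mul_one]
    nlinarith
  rw [intervalIntegral.integral_const_mul] at h
  have h0 := fejer_zero hT
  rw [fejer] at h0
  rw [h0] at h
  linarith

/-! ### Chebyshev bounds for weighted sums of Λ -/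

/-- Chebyshev's estimate, as a bound for `Λ(n) / n` in logarithmic windows of length one. -/
theorem sum_vonMangoldt_div_floor_log_le (s : Finset ℕ) (j : ℕ) :
    ∑ n ∈ s with ⌊Real.log (n : ℕ)⌋₊ = j, vonMangoldt n / n ≤
      (Real.log 4 + 4) * Real.exp 1 := by
  have hx : (0 : ℝ) ≤ Real.exp (j + 1) := (Real.exp_pos _).le
  have h1 : ∑ n ∈ s with ⌊Real.log (n : ℕ)⌋₊ = j, vonMangoldt n / n ≤
      Real.exp (-j) * Chebyshev.psi (Real.exp (j + 1)) := by
    rw [Chebyshev.psi, Finset.mul_sum]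
    -- Since `Real.log 0 = 0`, the index n = 0 falls into the window j = 0; its term is zero and is
    -- removed before using n ≥ e^j.
    calc _ ≤ ∑ n ∈ (s.filter fun n : ℕ => ⌊Real.log n⌋₊ = j).filter (· ≠ 0),
          Real.exp (-j) * vonMangoldt n := by
          rw [Finset.sum_filter (fun n : ℕ => n ≠ 0)]
          refine Finset.sum_le_sum fun n hn => ?_
          split_ifs with h0
          · rw [Finset.mem_filter] at hn
            have hn0 : (0 : ℝ) < n := by positivity
            have : Real.exp j ≤ n := by
              rw [← Real.le_log_iff_exp_le hn0, ← hn.2]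
              exact Nat.floor_le (Real.log_natCast_nonneg n)
            rw [Real.exp_neg, div_eq_inv_mul]
            exact mul_le_mul_of_nonneg_right (inv_anti₀ (Real.exp_pos _) this)
              ArithmeticFunction.vonMangoldt_nonneg
          · rw [not_not] at h0; simp [h0]
      _ ≤ _ := by
          refine Finset.sum_le_sum_of_subset_of_nonneg (fun n hn => ?_) fun n _ _ =>
            mul_nonneg (Real.exp_pos _).le ArithmeticFunction.vonMangoldt_nonneg
          simp only [Finset.mem_filter, ne_eq] at hn
          have hn0 : (0 : ℝ) < n := by have := hn.2; positivity
          refine Finset.mem_Ioc.2 ⟨Nat.pos_of_ne_zero hn.2, Nat.le_floor ?_⟩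
          rw [← Real.log_le_iff_le_exp hn0, ← hn.1.2]
          exact (Nat.lt_floor_add_one _).le
  refine h1.trans ?_
  have h2 := Chebyshev.psi_le_const_mul_self hx
  calc _ ≤ Real.exp (-j) * ((Real.log 4 + 4) * Real.exp (j + 1)) := by gcongr
    _ = (Real.log 4 + 4) * (Real.exp (-j) * Real.exp (j + 1)) := by ring
    _ = _ := by rw [← Real.exp_add]; ring_nf

/-- Each logarithmic window of length one has bounded mass, and the weights at distance k from x are
O(1/(1+k²)), hence summable. The uniformity in x is what matters later. -/
theorem exists_sum_vonMangoldt_div_le :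
    ∃ C : ℝ, 0 < C ∧ ∀ (x : ℝ) (s : Finset ℕ),
      ∑ n ∈ s, vonMangoldt n / n / (1 + (x - Real.log n) ^ 2) ≤ C := by
  have hS : Summable fun i : ℤ => 3 / (1 + (i : ℝ) ^ 2) := by
    refine Summable.of_nonneg_of_le (fun i => by positivity) (fun i => ?_)
      (((Real.summable_one_div_int_pow (p := 2)).2 (by norm_num)).mul_left 3 |>.add
        (summable_of_ne_finset_zero (f := fun i : ℤ => if i = 0 then (3 : ℝ) else 0) (s := {0})
          (by intro b hb; simp at hb; simp [hb])))
    split_ifs with h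
    · simp [h]
    · have : (0 : ℝ) < (i : ℝ) ^ 2 := by positivity
      rw [add_zero, ← mul_div_assoc, mul_one]
      gcongr
      linarith
  set B : ℝ := (Real.log 4 + 4) * Real.exp 1 with hB
  have hB0 : 0 < B := by
    have : 0 < Real.log 4 := Real.log_pos (by norm_num)
    positivity
  set S : ℝ := ∑' i : ℤ, 3 / (1 + (i : ℝ) ^ 2) with hSdef
  have hS0 : 0 ≤ S := tsum_nonneg fun i => by positivity
  refine ⟨B * (S + 1), by positivity, fun x s => ?_⟩
  -- The 3 pays for the two floors: they move u = x − log n by at most 1, and 1 + (|u|+1)² ≤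
  -- 3(1+u²).
  have key : ∀ n : ℕ, 1 / (1 + (x - Real.log n) ^ 2) ≤
      3 / (1 + (((⌊Real.log n⌋₊ : ℤ) - ⌊x⌋ : ℤ) : ℝ) ^ 2) := by
    intro n
    have h1 := Nat.floor_le (Real.log_natCast_nonneg n)
    have h2 := Nat.lt_floor_add_one (Real.log n)
    have h3 := Int.floor_le x
    have h4 := Int.lt_floor_add_one x
    push_cast
    set m : ℝ := (⌊Real.log n⌋₊ : ℝ)
    set k : ℝ := (⌊x⌋ : ℝ)
    have h5 : (m - k) ^ 2 ≤ (|x - Real.log n| + 1) ^ 2 := by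
      rw [← sq_abs (m - k)]
      gcongr
      rw [abs_le]
      constructor
      · linarith [le_abs_self (x - Real.log n)]
      · linarith [neg_abs_le (x - Real.log n)]
    have h6 := sq_abs (x - Real.log n)
    rw [div_le_div_iff₀ (by positivity) (by positivity)]
    nlinarith [sq_nonneg (|x - Real.log n| - 1)]
  calc ∑ n ∈ s, vonMangoldt n / n / (1 + (x - Real.log n) ^ 2)
      ≤ ∑ n ∈ s, vonMangoldt n / n * (3 / (1 + (((⌊Real.log n⌋₊ : ℤ) - ⌊x⌋ : ℤ) : ℝ) ^ 2)) := by
        refine Finset.sum_le_sum fun n _ => ?_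
        rw [div_eq_mul_one_div (vonMangoldt n / n)]
        exact mul_le_mul_of_nonneg_left (key n)
          (div_nonneg ArithmeticFunction.vonMangoldt_nonneg n.cast_nonneg)
    _ = ∑ j ∈ s.image (fun n : ℕ => ⌊Real.log n⌋₊), ∑ n ∈ s with ⌊Real.log (n : ℕ)⌋₊ = j,
          vonMangoldt n / n * (3 / (1 + (((⌊Real.log n⌋₊ : ℤ) - ⌊x⌋ : ℤ) : ℝ) ^ 2)) :=
        (Finset.sum_fiberwise_of_maps_to (fun n hn => Finset.mem_image_of_mem _ hn) _).symm
    _ ≤ ∑ j ∈ s.image (fun n : ℕ => ⌊Real.log n⌋₊),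
          B * (3 / (1 + (((j : ℤ) - ⌊x⌋ : ℤ) : ℝ) ^ 2)) := by
        refine Finset.sum_le_sum fun j _ => ?_
        refine le_trans (le_of_eq ?_) (mul_le_mul_of_nonneg_right
          (sum_vonMangoldt_div_floor_log_le s j) (by positivity))
        rw [Finset.sum_mul]
        refine Finset.sum_congr rfl fun n hn => ?_
        rw [(Finset.mem_filter.1 hn).2]
    _ = B * ∑ i ∈ (s.image (fun n : ℕ => ⌊Real.log n⌋₊)).image (fun j : ℕ => (j : ℤ) - ⌊x⌋),
          3 / (1 + (i : ℝ) ^ 2) := by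
        rw [Finset.sum_image (g := fun j : ℕ => (j : ℤ) - ⌊x⌋) (fun a _ b _ h => by simpa using h),
          Finset.mul_sum]
    _ ≤ B * S := mul_le_mul_of_nonneg_left
        (hS.sum_le_tsum _ fun i _ => by positivity) hB0.le
    _ ≤ B * (S + 1) := by gcongr; linarith

/-! ### Smoothed sums of Λ and the line Re s = 1 -/

/-- The Dirichlet series of `Λ - 1` extends continuously to the line `re s = 1`. -/
theorem exists_continuousOn_LSeriesHasSum_vonMangoldt_sub_one :
    ∃ H : ℂ → ℂ, ContinuousOn H {s | 1 ≤ s.re} ∧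
      ∀ s : ℂ, 1 < s.re → LSeriesHasSum (fun n => (vonMangoldt n : ℂ) - 1) s (H s) := by
  classical
  -- ζ(s) − 1/(s−1), with Euler's constant filling the removable singularity. Its counterpart for
  -- −ζ'/ζ is `LFunctionResidueClassAux` at modulus 1, whose continuity encodes the non-vanishing of
  -- ζ on Re s = 1; the two poles cancel in the difference.
  set Z : ℂ → ℂ := Function.update (fun s => riemannZeta s - 1 / (s - 1)) 1
    Real.eulerMascheroniConstant with hZ
  have hZc : Continuous Z := by
    rw [continuous_iff_continuousAt]
    intro s
    rcases eq_or_ne s 1 with rfl | hs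
    · exact continuousAt_update_same.2 tendsto_riemannZeta_sub_one_div
    · rw [hZ, continuousAt_update_of_ne hs]
      exact (differentiableAt_riemannZeta hs).continuousAt.sub
        (continuousAt_const.div (continuousAt_id.sub continuousAt_const) (sub_ne_zero.2 hs))
  refine ⟨fun s => ArithmeticFunction.vonMangoldt.LFunctionResidueClassAux (1 : ZMod 1) s - Z s,
    (ArithmeticFunction.vonMangoldt.continuousOn_LFunctionResidueClassAux _).sub
      hZc.continuousOn, fun s hs => ?_⟩
  have hs1 : s ≠ 1 := by rintro rfl; simp at hs
  have h1 := ArithmeticFunction.vonMangoldt.eqOn_LFunctionResidueClassAux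
    (q := 1) (a := 1) isUnit_one hs
  have h2 : (fun n : ℕ => ((ArithmeticFunction.vonMangoldt.residueClass (1 : ZMod 1) n : ℝ) : ℂ)) =
      fun n : ℕ => (vonMangoldt n : ℂ) := by
    ext n
    rw [ArithmeticFunction.vonMangoldt.residueClass, Set.indicator_of_mem]
    exact Subsingleton.elim _ _
  simp only [h2] at h1
  have h3 := (ArithmeticFunction.LSeriesSummable_vonMangoldt hs).LSeriesHasSum.sub
    (LSeriesHasSum_one hs)
  have h4 : LSeries (fun n : ℕ => (vonMangoldt n : ℂ)) s - riemannZeta s =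
      ArithmeticFunction.vonMangoldt.LFunctionResidueClassAux (1 : ZMod 1) s - Z s := by
    rw [h1, hZ, Function.update_of_ne hs1]
    simp
  rw [h4] at h3
  exact h3

theorem continuous_comp_verticalLine {H : ℂ → ℂ} (hH : ContinuousOn H {s | 1 ≤ s.re}) {σ : ℝ}
    (hσ : 1 ≤ σ) : Continuous fun t : ℝ => H (σ + Complex.I * t) :=
  hH.comp_continuous (by fun_prop) fun t => by simpa using hσ

/-- Integrate the Dirichlet series termwise: e^{itx} n^{-it} = e^{it(x − log n)}, and its real part
against 1 − t/T gives the kernel because the coefficients are real. -/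
theorem hasSum_mul_fejer {H : ℂ → ℂ} {a : ℕ → ℝ} {σ : ℝ}
    (hH : ∀ t : ℝ, LSeriesHasSum (fun n => (a n : ℂ)) (σ + Complex.I * t) (H (σ + Complex.I * t)))
    (hσ : 1 < σ) {T : ℝ} (hT : 0 < T) (x : ℝ) :
    HasSum (fun n : ℕ => a n * (n : ℝ) ^ (-σ) * fejer T (x - Real.log n))
      (∫ t in (0 : ℝ)..T, ((1 - t / T : ℝ) : ℂ) * Complex.exp (Complex.I * (t * x : ℝ)) *
        H (σ + Complex.I * t)).re := by
  set F : ℕ → ℝ → ℂ := fun n t => ((1 - t / T : ℝ) : ℂ) *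
    ((a n * (n : ℝ) ^ (-σ) : ℝ) * Complex.exp (Complex.I * (t * (x - Real.log n) : ℝ))) with hF
  have hterm : ∀ (n : ℕ) (t : ℝ), F n t = ((1 - t / T : ℝ) : ℂ) *
      Complex.exp (Complex.I * (t * x : ℝ)) *
        LSeries.term (fun n => (a n : ℂ)) (σ + Complex.I * t) n := by
    intro n t
    rcases eq_or_ne n 0 with rfl | hn
    · simp [hF, Real.zero_rpow (by linarith : -σ ≠ 0)]
    · have hn' : (n : ℂ) ≠ 0 := by exact_mod_cast hn
      rw [LSeries.term_of_ne_zero hn, div_eq_mul_inv (a n : ℂ), ← Complex.cpow_neg]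
      simp only [hF]
      have h1 : (((n : ℝ) ^ (-σ) : ℝ) : ℂ) = Complex.exp (Complex.log n * (-σ)) := by
        rw [Complex.ofReal_cpow n.cast_nonneg, Complex.cpow_def_of_ne_zero (by simpa using hn)]
        simp
      have h2 : Complex.log n = (Real.log n : ℂ) := by simp
      rw [Complex.ofReal_mul (a n), h1, Complex.cpow_def_of_ne_zero hn', h2]
      have h3 : Complex.exp (Complex.log n * (-σ)) *
            Complex.exp (Complex.I * (t * (x - Real.log n) : ℝ)) =
          Complex.exp (Complex.I * (t * x : ℝ)) *
            Complex.exp ((Real.log n : ℂ) * -(σ + Complex.I * t)) := by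
        rw [← Complex.exp_add, ← Complex.exp_add, h2]
        congr 1
        push_cast
        ring
      rw [h2] at h3
      linear_combination ((1 - t / T : ℝ) : ℂ) * a n * h3
  have hsum : Summable fun n : ℕ => ‖LSeries.term (fun n => (a n : ℂ)) (σ : ℂ) n‖ := by
    have := (hH 0).LSeriesSummable.norm
    simpa using this
  have hnorm : ∀ (n : ℕ) (t : ℝ), ‖LSeries.term (fun n => (a n : ℂ)) (σ + Complex.I * t) n‖ =
      ‖LSeries.term (fun n => (a n : ℂ)) (σ : ℂ) n‖ := by
    intro n t
    rw [LSeries.norm_term_eq, LSeries.norm_term_eq]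
    simp
  have key : HasSum (fun n => ∫ t in (0 : ℝ)..T, F n t)
      (∫ t in (0 : ℝ)..T, ((1 - t / T : ℝ) : ℂ) * Complex.exp (Complex.I * (t * x : ℝ)) *
        H (σ + Complex.I * t)) := by
    refine intervalIntegral.hasSum_integral_of_dominated_convergence
      (fun n _ => ‖LSeries.term (fun n => (a n : ℂ)) (σ : ℂ) n‖) (fun n => ?_) (fun n => ?_)
      (Eventually.of_forall fun t _ => hsum) intervalIntegrable_const ?_
    · exact Continuous.aestronglyMeasurable (by fun_prop)
    · refine Eventually.of_forall fun t ht => ?_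
      rw [Set.uIoc_of_le hT.le] at ht
      rw [hterm, norm_mul, norm_mul, hnorm, mul_comm Complex.I, Complex.norm_exp_ofReal_mul_I,
        mul_one, Complex.norm_real]
      refine mul_le_of_le_one_left (norm_nonneg _) ?_
      rw [Real.norm_eq_abs, abs_le]
      have h1 : t / T ≤ 1 := (div_le_one hT).2 ht.2
      have h2 : 0 < t / T := div_pos ht.1 hT
      constructor <;> linarith
    · refine Eventually.of_forall fun t _ => ?_
      simp only [hterm]
      exact (hH t).mul_left _
  refine (Complex.hasSum_re key).congr_fun ?_
  intro n
  have hFint : IntervalIntegrable (F n) MeasureTheory.volume 0 T :=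
    Continuous.intervalIntegrable (by fun_prop) _ _
  have h1 : (∫ t in (0 : ℝ)..T, F n t).re = ∫ t in (0 : ℝ)..T, (F n t).re := by
    have := Complex.reCLM.intervalIntegral_comp_comm hFint
    simpa using this.symm
  rw [h1, fejer, ← intervalIntegral.integral_const_mul]
  refine intervalIntegral.integral_congr fun t _ => ?_
  simp only [hF]
  rw [mul_comm Complex.I, Complex.re_ofReal_mul, Complex.re_ofReal_mul, Complex.exp_ofReal_mul_I_re]
  ring

theorem tendsto_integral_verticalLine {H : ℂ → ℂ} (hH : ContinuousOn H {s | 1 ≤ s.re})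
    (T x : ℝ) :
    Tendsto (fun σ : ℝ => ∫ t in (0 : ℝ)..T, ((1 - t / T : ℝ) : ℂ) *
        Complex.exp (Complex.I * (t * x : ℝ)) * H (σ + Complex.I * t)) (𝓝[>] 1)
      (𝓝 (∫ t in (0 : ℝ)..T, ((1 - t / T : ℝ) : ℂ) *
        Complex.exp (Complex.I * (t * x : ℝ)) * H ((1 : ℝ) + Complex.I * t))) := by
  have hK : IsCompact (Set.Icc (1 : ℝ) 2 ×ˢ Set.uIcc 0 T) := isCompact_Icc.prod isCompact_uIcc
  set g : ℝ × ℝ → ℂ := fun p => ((1 - p.2 / T : ℝ) : ℂ) *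
        Complex.exp (Complex.I * (p.2 * x : ℝ)) * H (p.1 + Complex.I * p.2) with hg
  have hgc : ContinuousOn g (Set.Icc (1 : ℝ) 2 ×ˢ Set.uIcc 0 T) := by
    refine ContinuousOn.mul (Continuous.continuousOn (by fun_prop)) ?_
    refine hH.comp (Continuous.continuousOn (by fun_prop)) fun p hp => ?_
    simpa using hp.1.1
  obtain ⟨C, hC⟩ := hK.exists_bound_of_continuousOn hgc
  have hev : ∀ᶠ σ : ℝ in 𝓝[>] 1, σ ∈ Set.Icc (1 : ℝ) 2 := by
    filter_upwards [Ioo_mem_nhdsGT (show (1 : ℝ) < 2 by norm_num)] with σ hσ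
    exact ⟨hσ.1.le, hσ.2.le⟩
  refine intervalIntegral.tendsto_integral_filter_of_dominated_convergence (fun _ => C) ?_ ?_
    intervalIntegrable_const ?_
  · filter_upwards [hev] with σ hσ
    exact (Continuous.mul (by fun_prop)
      (continuous_comp_verticalLine hH hσ.1)).aestronglyMeasurable
  · filter_upwards [hev] with σ hσ
    exact Eventually.of_forall fun t ht => hC (σ, t) ⟨hσ, Set.uIoc_subset_uIcc ht⟩
  · refine Eventually.of_forall fun t _ => Tendsto.const_mul _ ?_
    have h1 : ContinuousWithinAt (fun σ : ℝ => H (σ + Complex.I * t)) (Set.Ici 1) 1 := by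
      have : ContinuousOn (fun σ : ℝ => H (σ + Complex.I * t)) (Set.Ici 1) :=
        hH.comp (Continuous.continuousOn (by fun_prop)) fun σ hσ => by simpa using hσ
      exact this 1 Set.self_mem_Ici
    exact h1.tendsto.mono_left (nhdsWithin_mono _ Set.Ioi_subset_Ici_self)

/-- Riemann–Lebesgue, with the frequency rescaled to −x/(2π). For a non-integrable `f` the integrals
take the default value 0. -/
theorem tendsto_integral_exp_mul_atTop (f : ℝ → ℂ) {T : ℝ} (hT : 0 < T) :
    Tendsto (fun x : ℝ => ∫ t in (0 : ℝ)..T, Complex.exp (Complex.I * (t * x : ℝ)) * f t) atTop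
      (𝓝 0) := by
  have h := Real.tendsto_integral_exp_smul_cocompact ((Set.Ioc 0 T).indicator f)
  have h2 : Tendsto (fun x : ℝ => -(x / (2 * Real.pi))) atTop (cocompact ℝ) :=
    (tendsto_neg_atTop_atBot.comp (tendsto_id.atTop_div_const (by positivity))).mono_right
      atBot_le_cocompact
  refine (h.comp h2).congr fun x => ?_
  rw [intervalIntegral.integral_of_le hT.le, ← MeasureTheory.integral_indicator measurableSet_Ioc]
  refine MeasureTheory.integral_congr_ae (Eventually.of_forall fun t => ?_)
  by_cases ht : t ∈ Set.Ioc 0 T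
  · simp only [Set.indicator_of_mem ht, Circle.smul_def, Real.fourierChar_apply, smul_eq_mul]
    congr 2
    push_cast
    field_simp
  · simp [Set.indicator_of_notMem ht]

/-- By positivity only the n with x ≤ log n ≤ x + 1/T are kept. There the kernel is at least T/4,
and there are at least e^{x+1/T} − e^x − 1 such n. -/
theorem le_tsum_rpow_mul_fejer {T : ℝ} (hT : 0 < T) (x : ℝ) {σ : ℝ} (hσ : 1 < σ) :
    (Real.exp (x + 1 / T) - Real.exp x - 1) * (Real.exp (x + 1 / T) ^ (-σ) * (T / 4)) ≤
      ∑' n : ℕ, (n : ℝ) ^ (-σ) * fejer T (x - Real.log n) := by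
  have hs : Summable fun n : ℕ => (n : ℝ) ^ (-σ) * fejer T (x - Real.log n) :=
    Summable.of_nonneg_of_le
      (fun n => mul_nonneg (Real.rpow_nonneg n.cast_nonneg _) (fejer_nonneg hT _))
      (fun n => mul_le_mul_of_nonneg_left (fejer_le hT _) (Real.rpow_nonneg n.cast_nonneg _))
      ((Real.summable_nat_rpow.2 (by linarith)).mul_right (T / 2))
  set b := Real.exp (x + 1 / T) with hb
  set a := Real.exp x with ha
  have ha0 : 0 < a := Real.exp_pos _
  have hb0 : 0 < b := Real.exp_pos _
  refine le_trans ?_ (hs.sum_le_tsum (Finset.Icc ⌈a⌉₊ ⌊b⌋₊)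
    fun n _ => mul_nonneg (Real.rpow_nonneg n.cast_nonneg _) (fejer_nonneg hT _))
  have hcard : b - a - 1 ≤ ((Finset.Icc ⌈a⌉₊ ⌊b⌋₊).card : ℝ) := by
    rw [Nat.card_Icc]
    have h1 := Nat.lt_floor_add_one b
    have h2 := Nat.ceil_lt_add_one ha0.le
    have h3 : ((⌊b⌋₊ + 1 : ℕ) : ℝ) ≤ ((⌊b⌋₊ + 1 - ⌈a⌉₊ : ℕ) : ℝ) + (⌈a⌉₊ : ℝ) := by
      exact_mod_cast le_tsub_add
    push_cast at h3
    linarith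
  calc (b - a - 1) * (b ^ (-σ) * (T / 4))
      ≤ ((Finset.Icc ⌈a⌉₊ ⌊b⌋₊).card : ℝ) * (b ^ (-σ) * (T / 4)) := by gcongr
    _ = ∑ n ∈ Finset.Icc ⌈a⌉₊ ⌊b⌋₊, b ^ (-σ) * (T / 4) := by simp
    _ ≤ _ := by
      refine Finset.sum_le_sum fun n hn => ?_
      rw [Finset.mem_Icc] at hn
      have h1 : a ≤ n := Nat.ceil_le.1 hn.1
      have h2 : (n : ℝ) ≤ b := (Nat.le_floor_iff hb0.le).1 hn.2
      have hn0 : (0 : ℝ) < n := ha0.trans_le h1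
      have h3 : x ≤ Real.log n := (Real.le_log_iff_exp_le hn0).2 h1
      have h4 : Real.log n ≤ x + 1 / T := (Real.log_le_iff_le_exp hn0).2 h2
      refine mul_le_mul (Real.rpow_le_rpow_of_nonpos hn0 h2 (by linarith))
        (le_fejer hT ?_) (by positivity) (Real.rpow_nonneg n.cast_nonneg _)
      rw [abs_mul, abs_of_pos hT, abs_of_nonpos (by linarith)]
      have : T * (1 / T) = 1 := by field_simp
      nlinarith

theorem summable_vonMangoldt_div_mul_fejer {T : ℝ} (hT : 0 < T) (x : ℝ) :
    Summable fun n : ℕ => vonMangoldt n / n * fejer T (x - Real.log n) := by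
  obtain ⟨C, -, hC⟩ := exists_sum_vonMangoldt_div_le
  have h0 : ∀ n : ℕ, 0 ≤ vonMangoldt n / n := fun n =>
    div_nonneg ArithmeticFunction.vonMangoldt_nonneg n.cast_nonneg
  have hs : Summable fun n : ℕ => vonMangoldt n / n / (1 + (x - Real.log n) ^ 2) :=
    summable_of_sum_le (fun n => div_nonneg (h0 n) (by positivity)) (hC x)
  refine Summable.of_nonneg_of_le (fun n => mul_nonneg (h0 n) (fejer_nonneg hT _))
    (fun n => ?_) (hs.mul_right (T / 2 + 2 / T))
  calc _ ≤ vonMangoldt n / n * ((T / 2 + 2 / T) / (1 + (x - Real.log n) ^ 2)) :=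
        mul_le_mul_of_nonneg_left (fejer_le_div hT _) (h0 n)
    _ = _ := by ring

/-- Write Λ = 1 + (Λ − 1) at σ > 1 and let σ → 1⁺. The right-hand side is already taken at σ = 1,
which is legitimate since n^{-σ} ≤ 1/n and all terms are nonnegative. The 1/8 is a lower bound for
(1 − e^{-1/T})·T/4. -/
theorem le_tsum_vonMangoldt_mul_fejer {H : ℂ → ℂ} (hH : ContinuousOn H {s | 1 ≤ s.re})
    (hL : ∀ s : ℂ, 1 < s.re → LSeriesHasSum (fun n => (vonMangoldt n : ℂ) - 1) s (H s))
    {T : ℝ} (hT : 1 ≤ T) (x : ℝ) :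
    1 / 8 - T / 4 * Real.exp (-x) +
      (∫ t in (0 : ℝ)..T, ((1 - t / T : ℝ) : ℂ) * Complex.exp (Complex.I * (t * x : ℝ)) *
        H ((1 : ℝ) + Complex.I * t)).re ≤
      ∑' n : ℕ, vonMangoldt n / n * fejer T (x - Real.log n) := by
  have hT0 : 0 < T := by linarith
  set b := Real.exp (x + 1 / T) with hb
  have hb0 : 0 < b := Real.exp_pos _
  have hlim : Tendsto (fun σ : ℝ => (b - Real.exp x - 1) * (b ^ (-σ) * (T / 4)) +
      (∫ t in (0 : ℝ)..T, ((1 - t / T : ℝ) : ℂ) * Complex.exp (Complex.I * (t * x : ℝ)) *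
        H (σ + Complex.I * t)).re) (𝓝[>] 1)
      (𝓝 ((b - Real.exp x - 1) * (b ^ (-1 : ℝ) * (T / 4)) +
      (∫ t in (0 : ℝ)..T, ((1 - t / T : ℝ) : ℂ) * Complex.exp (Complex.I * (t * x : ℝ)) *
        H ((1 : ℝ) + Complex.I * t)).re)) := by
    refine Tendsto.add (Tendsto.const_mul _ (Tendsto.mul_const _ ?_))
      ((Complex.continuous_re.tendsto _).comp (tendsto_integral_verticalLine hH T x))
    have : Continuous fun σ : ℝ => b ^ (-σ) :=
      Continuous.rpow continuous_const continuous_neg fun _ => Or.inl hb0.ne'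
    exact (this.tendsto 1).mono_left nhdsWithin_le_nhds
  have hle : (b - Real.exp x - 1) * (b ^ (-1 : ℝ) * (T / 4)) +
      (∫ t in (0 : ℝ)..T, ((1 - t / T : ℝ) : ℂ) * Complex.exp (Complex.I * (t * x : ℝ)) *
        H ((1 : ℝ) + Complex.I * t)).re ≤
      ∑' n : ℕ, vonMangoldt n / n * fejer T (x - Real.log n) := by
    refine le_of_tendsto hlim ?_
    filter_upwards [self_mem_nhdsWithin] with σ hσ
    have hσ : 1 < σ := hσ
    have h1 := hasSum_mul_fejer (a := fun n => vonMangoldt n - 1) (H := H) (σ := σ)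
      (fun t => by simpa using hL (σ + Complex.I * t) (by simpa using hσ)) hσ hT0 x
    have hs : Summable fun n : ℕ => (n : ℝ) ^ (-σ) * fejer T (x - Real.log n) :=
      Summable.of_nonneg_of_le
        (fun n => mul_nonneg (Real.rpow_nonneg n.cast_nonneg _) (fejer_nonneg hT0 _))
        (fun n => mul_le_mul_of_nonneg_left (fejer_le hT0 _) (Real.rpow_nonneg n.cast_nonneg _))
        ((Real.summable_nat_rpow.2 (by linarith)).mul_right (T / 2))
    have h2 := hs.hasSum.add h1
    refine le_trans (add_le_add_left (le_tsum_rpow_mul_fejer hT0 x hσ) _) ?_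
    refine hasSum_le (fun n => ?_) h2 (summable_vonMangoldt_div_mul_fejer hT0 x).hasSum
    have h3 : vonMangoldt n * (n : ℝ) ^ (-σ) ≤ vonMangoldt n / n := by
      rcases Nat.eq_zero_or_pos n with rfl | hn
      · simp
      · rw [div_eq_mul_inv, ← Real.rpow_neg_one]
        refine mul_le_mul_of_nonneg_left ?_ ArithmeticFunction.vonMangoldt_nonneg
        exact Real.rpow_le_rpow_of_exponent_le (by exact_mod_cast hn) (by linarith)
    calc _ = vonMangoldt n * (n : ℝ) ^ (-σ) * fejer T (x - Real.log n) := by ring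
      _ ≤ _ := mul_le_mul_of_nonneg_right h3 (fejer_nonneg hT0 _)
  refine le_trans (add_le_add_left ?_ _) hle
  have hv : 0 < 1 / T := by positivity
  have hv1 : 1 / T ≤ 1 := by rw [div_le_one hT0]; exact hT
  -- With v = 1/T: e^{-v} ≤ 1/(1+v) ≤ 1 − v/2, the last inequality needing v ≤ 1.
  have h1 : Real.exp (-(1 / T)) ≤ 1 - 1 / (2 * T) := by
    have h2 : Real.exp (-(1 / T)) ≤ 1 / (1 + 1 / T) := by
      rw [Real.exp_neg, ← one_div]
      exact one_div_le_one_div_of_le (by positivity) (by linarith [Real.add_one_le_exp (1 / T)])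
    refine h2.trans ?_
    rw [div_le_iff₀ (by positivity)]
    have : 1 / (2 * T) = (1 / T) / 2 := by field_simp
    rw [this]
    nlinarith
  have h2 : (b - Real.exp x - 1) * (b ^ (-1 : ℝ) * (T / 4)) =
      (1 - Real.exp (-(1 / T)) - Real.exp (-x) * Real.exp (-(1 / T))) * (T / 4) := by
    rw [Real.rpow_neg_one, hb, Real.exp_add, Real.exp_neg, Real.exp_neg]
    have := Real.exp_pos x
    have := Real.exp_pos (1 / T)
    field_simp
  rw [h2]
  have h3 : Real.exp (-(1 / T)) ≤ 1 := Real.exp_le_one_iff.2 (by linarith)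
  have h4 : Real.exp (-x) * Real.exp (-(1 / T)) ≤ Real.exp (-x) :=
    mul_le_of_le_one_right (Real.exp_pos _).le h3
  have h5 : 1 / (2 * T) * (T / 4) = 1 / 8 := by field_simp; norm_num
  nlinarith

/-! ### Primes in [x, (1+ε)x] -/

/-- ∑ Λ(n)/n over non-primes converges and the kernel tends to 0 at each fixed n, so dominated
convergence applies. -/
theorem tendsto_tsum_nonprime_mul_fejer {T : ℝ} (hT : 0 < T) :
    Tendsto (fun x : ℝ => ∑' n : ℕ,
      (if n.Prime then 0 else vonMangoldt n) / n * fejer T (x - Real.log n)) atTop (𝓝 0) := by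
  have hs : Summable fun n : ℕ => (if n.Prime then 0 else vonMangoldt n) / (n : ℝ) := by
    have := ArithmeticFunction.vonMangoldt.summable_residueClass_non_primes_div (1 : ZMod 1)
    refine this.congr fun n => ?_
    rw [ArithmeticFunction.vonMangoldt.residueClass, Set.indicator_of_mem]
    exact Subsingleton.elim _ _
  have h0 : ∀ n : ℕ, 0 ≤ (if n.Prime then 0 else vonMangoldt n) / (n : ℝ) := fun n => by
    split_ifs
    · simp
    · exact div_nonneg ArithmeticFunction.vonMangoldt_nonneg n.cast_nonneg
  suffices h : Tendsto (fun x : ℝ => ∑' n : ℕ,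
      (if n.Prime then 0 else vonMangoldt n) / n * fejer T (x - Real.log n)) atTop
      (𝓝 (∑' _ : ℕ, (0 : ℝ))) by rwa [tsum_zero] at h
  refine tendsto_tsum_of_dominated_convergence (hs.mul_right (T / 2)) (fun n => ?_)
    (Eventually.of_forall fun x n => ?_)
  · suffices h : Tendsto (fun x : ℝ => fejer T (x - Real.log n)) atTop (𝓝 0) by
      simpa only [mul_zero] using h.const_mul ((if n.Prime then 0 else vonMangoldt n) / (n : ℝ))
    refine tendsto_of_tendsto_of_tendsto_of_le_of_le tendsto_const_nhds ?_
      (fun x => fejer_nonneg hT _) (fun x => fejer_le_div hT _)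
    refine Tendsto.div_atTop tendsto_const_nhds ?_
    refine tendsto_atTop_add_const_left _ _ ?_
    exact (tendsto_pow_atTop two_ne_zero).comp (tendsto_atTop_add_const_right _ _ tendsto_id)
  · rw [Real.norm_of_nonneg (mul_nonneg (h0 n) (fejer_nonneg hT _))]
    exact mul_le_mul_of_nonneg_left (fejer_le hT _) (h0 n)

/-- Primes at logarithmic distance at least η meet only the tail 2/(Tu²) of the kernel, so they
contribute O(1/T) uniformly in x. -/
theorem tsum_vonMangoldt_mul_fejer_le {C : ℝ}
    (hC : ∀ (x : ℝ) (s : Finset ℕ), ∑ n ∈ s, vonMangoldt n / n / (1 + (x - Real.log n) ^ 2) ≤ C)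
    {T : ℝ} (hT : 0 < T) {η : ℝ} (hη : 0 < η) {x : ℝ}
    (hx : ∀ p : ℕ, p.Prime → η ≤ |x - Real.log p|) :
    ∑' n : ℕ, vonMangoldt n / n * fejer T (x - Real.log n) ≤
      2 / T * (1 + 1 / η ^ 2) * C + ∑' n : ℕ,
        (if n.Prime then 0 else vonMangoldt n) / n * fejer T (x - Real.log n) := by
  have h0 : ∀ n : ℕ, 0 ≤ vonMangoldt n / n := fun n =>
    div_nonneg ArithmeticFunction.vonMangoldt_nonneg n.cast_nonneg
  have hs := summable_vonMangoldt_div_mul_fejer hT x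
  have hp : Summable fun n : ℕ =>
      (if n.Prime then 0 else vonMangoldt n) / n * fejer T (x - Real.log n) := by
    refine Summable.of_nonneg_of_le (fun n => mul_nonneg ?_ (fejer_nonneg hT _))
      (fun n => mul_le_mul_of_nonneg_right ?_ (fejer_nonneg hT _)) hs
    · split_ifs
      · simp
      · exact h0 n
    · split_ifs
      · simpa using h0 n
      · exact le_rfl
  have hw : Summable fun n : ℕ => vonMangoldt n / n / (1 + (x - Real.log n) ^ 2) :=
    summable_of_sum_le (fun n => div_nonneg (h0 n) (by positivity)) (hC x)
  have hwC : ∑' n : ℕ, vonMangoldt n / n / (1 + (x - Real.log n) ^ 2) ≤ C :=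
    Real.tsum_le_of_sum_le (fun n => div_nonneg (h0 n) (by positivity)) (hC x)
  calc _ ≤ ∑' n : ℕ, (2 / T * (1 + 1 / η ^ 2) *
          (vonMangoldt n / n / (1 + (x - Real.log n) ^ 2)) +
        (if n.Prime then 0 else vonMangoldt n) / n * fejer T (x - Real.log n)) := by
        refine hs.tsum_le_tsum (fun n => ?_) ((hw.mul_left _).add hp)
        split_ifs with hn
        · have h1 := hx n hn
          set u := x - Real.log n
          have h2 : η ^ 2 ≤ u ^ 2 := by
            rw [← sq_abs u]; gcongr
          have h3 := sq_mul_fejer_le hT u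
          have h4 : fejer T u ≤ 2 / T * (1 + 1 / η ^ 2) / (1 + u ^ 2) := by
            rw [le_div_iff₀ (by positivity)]
            have h5 : fejer T u * η ^ 2 ≤ 2 / T :=
              le_trans (by nlinarith [fejer_nonneg hT u]) h3
            have h6 : fejer T u ≤ 2 / T * (1 / η ^ 2) := by
              rw [mul_one_div, le_div_iff₀ (by positivity)]; exact h5
            nlinarith
          calc _ ≤ vonMangoldt n / n * (2 / T * (1 + 1 / η ^ 2) / (1 + u ^ 2)) :=
                mul_le_mul_of_nonneg_left h4 (h0 n)
            _ = _ := by ring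
        · have : 0 ≤ 2 / T * (1 + 1 / η ^ 2) *
              (vonMangoldt n / n / (1 + (x - Real.log n) ^ 2)) :=
            mul_nonneg (by positivity) (div_nonneg (h0 n) (by positivity))
          linarith
    _ = 2 / T * (1 + 1 / η ^ 2) * ∑' n : ℕ, vonMangoldt n / n / (1 + (x - Real.log n) ^ 2) +
        ∑' n : ℕ, (if n.Prime then 0 else vonMangoldt n) / n * fejer T (x - Real.log n) := by
        rw [(hw.mul_left _).tsum_add hp, tsum_mul_left]
    _ ≤ _ := by gcongr

theorem eventually_exists_prime_log_near {η : ℝ} (hη : 0 < η) :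
    ∀ᶠ x : ℝ in atTop, ∃ p : ℕ, p.Prime ∧ |x - Real.log p| < η := by
  obtain ⟨C, hC0, hC⟩ := exists_sum_vonMangoldt_div_le
  obtain ⟨H, hH, hL⟩ := exists_continuousOn_LSeriesHasSum_vonMangoldt_sub_one
  -- Makes the prime tails at most 1/16. The contradiction is then 1/8 − 1/64 − 1/64 > 1/16 + 1/64.
  set T : ℝ := 1 + 32 * ((1 + 1 / η ^ 2) * C) with hTdef
  have hD : 0 < (1 + 1 / η ^ 2) * C := by positivity
  have hT : 1 ≤ T := by linarith
  have hT0 : 0 < T := by linarith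
  have hmain : 2 / T * (1 + 1 / η ^ 2) * C ≤ 1 / 16 := by
    rw [mul_assoc, div_mul_eq_mul_div, div_le_iff₀ hT0]
    linarith
  have h1 := tendsto_tsum_nonprime_mul_fejer hT0
  have h2 : Tendsto (fun x : ℝ => T / 4 * Real.exp (-x)) atTop (𝓝 0) := by
    simpa using (Real.tendsto_exp_neg_atTop_nhds_zero).const_mul (T / 4)
  have h3 : Tendsto (fun x : ℝ => (∫ t in (0 : ℝ)..T, ((1 - t / T : ℝ) : ℂ) *
      Complex.exp (Complex.I * (t * x : ℝ)) * H ((1 : ℝ) + Complex.I * t)).re) atTop (𝓝 0) := by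
    have := (Complex.continuous_re.tendsto _).comp (tendsto_integral_exp_mul_atTop
      (fun t => ((1 - t / T : ℝ) : ℂ) * H ((1 : ℝ) + Complex.I * t)) hT0)
    rw [Complex.zero_re] at this
    refine this.congr fun x => ?_
    simp only [Function.comp]
    congr 2
    ext t
    ring
  filter_upwards [h1.eventually_lt_const (show (0 : ℝ) < 1 / 64 by norm_num),
    h2.eventually_lt_const (show (0 : ℝ) < 1 / 64 by norm_num),
    h3.eventually_const_lt (show -(1 / 64 : ℝ) < 0 by norm_num)] with x hx1 hx2 hx3
  by_contra! hcon
  have h4 := tsum_vonMangoldt_mul_fejer_le hC hT0 hη hcon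
  have h5 := le_tsum_vonMangoldt_mul_fejer hH hL hT x
  linarith

/-- For every `ε > 0` the interval `[x, (1 + ε) x]` contains a prime once `x` is large. -/
theorem eventually_exists_prime_mem_Icc {ε : ℝ} (hε : 0 < ε) :
    ∀ᶠ x : ℝ in atTop, ∃ p : ℕ, p.Prime ∧ x ≤ p ∧ (p : ℝ) ≤ (1 + ε) * x := by
  -- Half the logarithmic length of [x, (1+ε)x]; the previous result is applied at its logarithmic
  -- midpoint log x + η.
  set η : ℝ := Real.log (1 + ε) / 2 with hη
  have hη0 : 0 < η := by
    have := Real.log_pos (show 1 < 1 + ε by linarith)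
    positivity
  have ht : Tendsto (fun x : ℝ => Real.log x + η) atTop atTop :=
    tendsto_atTop_add_const_right _ _ Real.tendsto_log_atTop
  filter_upwards [ht.eventually (eventually_exists_prime_log_near hη0), eventually_gt_atTop 0]
    with x ⟨p, hp, hxp⟩ hx
  have hp0 : (0 : ℝ) < p := by exact_mod_cast hp.pos
  rw [abs_lt] at hxp
  refine ⟨p, hp, ?_, ?_⟩
  · rw [← Real.log_le_log_iff hx hp0]
    linarith
  · rw [← Real.log_le_log_iff hp0 (by positivity), Real.log_mul (by positivity) hx.ne']
    linarith

theorem le_primeCeil (x : ℝ) : (primeCeil x).Prime ∧ x ≤ primeCeil x := by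
  refine Nat.sInf_mem (s := {p : ℕ | p.Prime ∧ x ≤ p}) ?_
  obtain ⟨p, hp, hpp⟩ := Nat.exists_infinite_primes ⌈x⌉₊
  exact ⟨p, hpp, Nat.ceil_le.1 hp⟩

theorem tendsto_primeCeil_div : Tendsto (fun x : ℝ => (primeCeil x : ℝ) / x) atTop (𝓝 1) := by
  rw [tendsto_order]
  constructor
  · intro a ha
    filter_upwards [eventually_gt_atTop 0] with x hx
    refine ha.trans_le ?_
    rw [le_div_iff₀ hx, one_mul]
    exact (le_primeCeil x).2
  · intro a ha
    filter_upwards [eventually_gt_atTop 0,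
      eventually_exists_prime_mem_Icc (show 0 < (a - 1) / 2 by linarith)] with x hx ⟨p, hp, h1, h2⟩
    rw [div_lt_iff₀ hx]
    have h3 : (primeCeil x : ℝ) ≤ p := by
      exact_mod_cast Nat.sInf_le (s := {p : ℕ | p.Prime ∧ x ≤ p}) ⟨hp, h1⟩
    nlinarith

/-! ### The mean of φ(N)/N over N ≢ 2 mod 4 in short intervals -/

theorem totient_div_eq_sum_moebius {N : ℕ} (hN : 0 < N) :
    (N.totient : ℝ) / N = ∑ d ∈ N.divisors, (moebius d : ℝ) / d := by
  have h := (ArithmeticFunction.sum_eq_iff_sum_mul_moebius_eq (R := ℝ)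
    (f := fun n => (n.totient : ℝ)) (g := fun n => (n : ℝ))).1
      (fun n _ => by exact_mod_cast Nat.sum_totient n) N hN
  have hN0 : (N : ℝ) ≠ 0 := by positivity
  rw [← h, Nat.sum_divisorsAntidiagonal (fun a b => (moebius a : ℝ) * (b : ℝ)), Finset.sum_div]
  refine Finset.sum_congr rfl fun d hd => ?_
  have hdN := Nat.dvd_of_mem_divisors hd
  have hd0 : (d : ℝ) ≠ 0 := by
    have := Nat.pos_of_mem_divisors hd
    positivity
  rw [Nat.cast_div hdN hd0]
  field_simp

theorem hasSum_moebius_div_sq :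
    HasSum (fun n : ℕ => (moebius n : ℝ) / (n : ℝ) ^ 2) (6 / Real.pi ^ 2) := by
  have hs : 1 < (2 : ℂ).re := by norm_num
  have h1 : LSeries (fun n => ((moebius n : ℤ) : ℂ)) 2 = ((6 / Real.pi ^ 2 : ℝ) : ℂ) := by
    have h := LSeries_one_mul_Lseries_moebius hs
    rw [LSeries_one_eq_riemannZeta hs, riemannZeta_two] at h
    have hpi : (Real.pi : ℂ) ≠ 0 := by exact_mod_cast Real.pi_ne_zero
    push_cast
    field_simp at h ⊢
    linear_combination h
  have h2 := (ArithmeticFunction.LSeriesSummable_moebius_iff.2 hs).LSeriesHasSum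
  rw [h1, LSeriesHasSum] at h2
  rw [← Complex.hasSum_ofReal]
  refine h2.congr_fun fun n => ?_
  rcases eq_or_ne n 0 with rfl | hn
  · simp
  · rw [LSeries.term_of_ne_zero hn]
    push_cast
    norm_cast

theorem moebius_two_mul_odd (j : ℕ) : moebius (2 * (2 * j + 1)) = - moebius (2 * j + 1) := by
  rw [ArithmeticFunction.isMultiplicative_moebius.map_mul_of_coprime (by simp),
    ArithmeticFunction.moebius_apply_prime Nat.prime_two]
  ring

theorem moebius_two_mul_two_mul (j : ℕ) : moebius (2 * (2 * j)) = 0 := by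
  apply ArithmeticFunction.moebius_eq_zero_of_not_squarefree
  intro h
  have := h 2 ⟨j, by ring⟩
  simp at this

/-- The density of the multiples `N` of `d` with `N ≢ 2 mod 4`. -/
def multipleDensity (d : ℕ) : ℝ := 1 / d - 1 / (d.lcm 2 : ℕ) + 1 / (d.lcm 4 : ℕ)

theorem multipleDensity_odd (j : ℕ) :
    multipleDensity (2 * j + 1) = 3 / 4 * (1 / (2 * j + 1 : ℕ)) := by
  have h2 : (2 * j + 1).Coprime 2 := by simp
  have h4 : (2 * j + 1).Coprime 4 := by
    rw [show 4 = 2 ^ 2 by norm_num]; exact h2.pow_right 2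
  rw [multipleDensity, h2.lcm_eq_mul, h4.lcm_eq_mul]
  push_cast
  field_simp
  norm_num

theorem multipleDensity_two_mul_odd (j : ℕ) :
    multipleDensity (2 * (2 * j + 1)) = 1 / 2 * (1 / (2 * (2 * j + 1) : ℕ)) := by
  have h2 : (2 * j + 1).Coprime 2 := by simp
  have h3 : (2 * (2 * j + 1)).lcm 4 = 2 * ((2 * j + 1) * 2) := by
    rw [show 4 = 2 * 2 by norm_num, Nat.lcm_mul_left, h2.lcm_eq_mul]
  have h4 : (2 * (2 * j + 1)).lcm 2 = 2 * (2 * j + 1) :=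
    Nat.lcm_eq_left ⟨_, rfl⟩
  rw [multipleDensity, h3, h4]
  push_cast
  field_simp
  norm_num

/-- Let A be the sum of μ(d)/d² over odd d. As μ(2m) = −μ(m) for odd m and μ(4j) = 0, the even d
give −A/4, so 3A/4 = 6/π². The densities 3/(4d) for odd d and 1/(2d) for d ≡ 2 mod 4 then give (3/4
− 1/8)A = 5A/8. -/
theorem hasSum_moebius_mul_multipleDensity :
    HasSum (fun d : ℕ => (moebius d : ℝ) / d * multipleDensity d) (5 / Real.pi ^ 2) := by
  set f : ℕ → ℝ := fun n => (moebius n : ℝ) / (n : ℝ) ^ 2 with hf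
  have hsum := hasSum_moebius_div_sq
  set A := ∑' j : ℕ, f (2 * j + 1) with hA
  have hodd : HasSum (fun j : ℕ => f (2 * j + 1)) A :=
    (hsum.summable.comp_injective (i := fun j : ℕ => 2 * j + 1)
      fun a b h => by simpa using h).hasSum
  have heven : HasSum (fun k : ℕ => f (2 * k)) (0 + -(1 / 4) * A) := by
    refine HasSum.even_add_odd ?_ ?_
    · simp only [hf, moebius_two_mul_two_mul]
      simp
    · refine (hodd.mul_left (-(1 / 4))).congr_fun fun j => ?_
      simp only [hf, moebius_two_mul_odd]
      push_cast
      field_simp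
      norm_num
  have hAval : A = 8 / Real.pi ^ 2 := by
    have h := (heven.even_add_odd hodd).unique hsum
    have : 8 / Real.pi ^ 2 = 4 / 3 * (6 / Real.pi ^ 2) := by ring
    rw [this, ← h]
    ring
  have h5 : 5 / Real.pi ^ 2 = 1 / 2 * (0 + -(1 / 4) * A) + 3 / 4 * A := by
    rw [hAval]; ring
  rw [h5]
  refine HasSum.even_add_odd ?_ ?_
  · refine (heven.mul_left (1 / 2)).congr_fun fun k => ?_
    rcases Nat.even_or_odd' k with ⟨j, rfl | rfl⟩
    · simp [hf, moebius_two_mul_two_mul]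
    · simp only [hf, multipleDensity_two_mul_odd]
      field_simp
  · refine (hodd.mul_left (3 / 4)).congr_fun fun k => ?_
    simp only [hf, multipleDensity_odd]
    field_simp

theorem abs_card_filter_dvd_sub_le {a b : ℝ} (ha : 0 < a) (hab : a ≤ b) {m : ℕ} (hm : 0 < m) :
    |(((Finset.Icc ⌈a⌉₊ ⌊b⌋₊).filter (m ∣ ·)).card : ℝ) - (b - a) * (1 / m)| ≤ 1 := by
  have hm0 : (0 : ℝ) < m := by exact_mod_cast hm
  have hb : 0 ≤ b := ha.le.trans hab
  have himg : (Finset.Icc ⌈a⌉₊ ⌊b⌋₊).filter (m ∣ ·) =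
      (Finset.Icc ⌈a / m⌉₊ ⌊b / m⌋₊).image (m * ·) := by
    ext n
    simp only [Finset.mem_filter, Finset.mem_Icc, Finset.mem_image, Nat.ceil_le,
      Nat.le_floor_iff hb, Nat.le_floor_iff (div_nonneg hb hm0.le), div_le_iff₀ hm0,
      le_div_iff₀ hm0]
    constructor
    · rintro ⟨⟨h1, h2⟩, k, rfl⟩
      push_cast at h1 h2
      exact ⟨k, ⟨by linarith, by linarith⟩, rfl⟩
    · rintro ⟨k, ⟨h1, h2⟩, rfl⟩
      push_cast
      exact ⟨⟨by linarith, by linarith⟩, dvd_mul_right _ _⟩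
  rw [himg, Finset.card_image_of_injective _ fun x y h => Nat.eq_of_mul_eq_mul_left hm h,
    Nat.card_Icc]
  have hda : 0 ≤ a / m := by positivity
  have hdab : a / m ≤ b / m := by gcongr
  have h1 := Nat.ceil_lt_add_one hda
  have h2 := Nat.le_ceil (a / m)
  have h3 := Nat.lt_floor_add_one (b / m)
  have h4 := Nat.floor_le (hda.trans hdab)
  have hle : ⌈a / m⌉₊ ≤ ⌊b / m⌋₊ + 1 :=
    Nat.ceil_le.2 (by push_cast; linarith)
  rw [Nat.cast_sub hle]
  push_cast
  have h5 : (b - a) * (1 / m) = b / m - a / m := by ring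
  rw [h5, abs_le]
  constructor <;> linarith

/-- The indicator of N ≢ 2 mod 4 is 1 − 1_{2∣N} + 1_{4∣N}; each of the three counts of multiples is
off by at most 1. -/
theorem abs_card_shortConductors_dvd_sub_le {X δ : ℝ} (hX : 0 < X) {d : ℕ} (hd : 0 < d) :
    |(((shortConductors X δ).filter (d ∣ ·)).card : ℝ) - X ^ δ * multipleDensity d| ≤ 3 := by
  have hL : 0 ≤ X ^ δ := Real.rpow_nonneg hX.le _
  set I := Finset.Icc ⌈X⌉₊ ⌊X + X ^ δ⌋₊ with hI
  have hcount : (((shortConductors X δ).filter (d ∣ ·)).card : ℝ) =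
      ((I.filter (d ∣ ·)).card : ℝ) - ((I.filter (d.lcm 2 ∣ ·)).card : ℝ) +
        ((I.filter (d.lcm 4 ∣ ·)).card : ℝ) := by
    rw [shortConductors, Finset.filter_filter]
    simp only [Finset.card_filter, Nat.cast_sum, ← Finset.sum_sub_distrib,
      ← Finset.sum_add_distrib]
    refine Finset.sum_congr rfl fun n _ => ?_
    have h1 : d.lcm 2 ∣ n ↔ d ∣ n ∧ 2 ∣ n := Nat.lcm_dvd_iff
    have h2 : d.lcm 4 ∣ n ↔ d ∣ n ∧ 4 ∣ n := Nat.lcm_dvd_iff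
    have h3 : n ≡ 2 [MOD 4] ↔ 2 ∣ n ∧ ¬ 4 ∣ n := by
      rw [Nat.ModEq]; omega
    have h4 : 4 ∣ n → 2 ∣ n := fun h => dvd_trans (by norm_num) h
    simp only [h1, h2, h3]
    by_cases hd : d ∣ n <;> by_cases h2n : 2 ∣ n <;> by_cases h4n : 4 ∣ n <;>
      first
        | exact absurd (h4 h4n) h2n
        | simp [hd, h2n, h4n]
  have h0 := abs_card_filter_dvd_sub_le (b := X + X ^ δ) hX (by linarith) hd
  have h1 := abs_card_filter_dvd_sub_le (b := X + X ^ δ) hX (by linarith)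
    (Nat.lcm_pos hd (show 0 < 2 by norm_num))
  have h2 := abs_card_filter_dvd_sub_le (b := X + X ^ δ) hX (by linarith)
    (Nat.lcm_pos hd (show 0 < 4 by norm_num))
  rw [add_sub_cancel_left, abs_le] at h0 h1 h2
  rw [hcount, multipleDensity, abs_le]
  constructor <;> linarith

theorem sum_totient_div_shortConductors {X δ : ℝ} (hX : 0 < X) :
    ∑ N ∈ shortConductors X δ, (N.totient : ℝ) / N =
      ∑ d ∈ Finset.range (⌊X + X ^ δ⌋₊ + 1),
        (moebius d : ℝ) / d * (((shortConductors X δ).filter (d ∣ ·)).card : ℝ) := by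
  have h1 : ∀ N ∈ shortConductors X δ, (N.totient : ℝ) / N =
      ∑ d ∈ Finset.range (⌊X + X ^ δ⌋₊ + 1), if d ∣ N then (moebius d : ℝ) / d else 0 := by
    intro N hN
    rw [shortConductors, Finset.mem_filter, Finset.mem_Icc] at hN
    have hN0 : 0 < N := (Nat.ceil_pos.2 hX).trans_le hN.1.1
    rw [totient_div_eq_sum_moebius hN0, ← Finset.sum_filter]
    refine Finset.sum_congr ?_ fun _ _ => rfl
    ext d
    simp only [Nat.mem_divisors, Finset.mem_filter, Finset.mem_range]
    constructor
    · rintro ⟨h, -⟩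
      exact ⟨Nat.lt_succ_of_le ((Nat.le_of_dvd hN0 h).trans hN.1.2), h⟩
    · rintro ⟨-, h⟩
      exact ⟨h, hN0.ne'⟩
  rw [Finset.sum_congr rfl h1, Finset.sum_comm]
  refine Finset.sum_congr rfl fun d _ => ?_
  rw [← Finset.sum_filter, Finset.sum_const, nsmul_eq_mul, mul_comm]

/-- The counting errors 3/d add up to O(log X) over d ≤ X + X^δ ≤ 2X, negligible against X^δ for any
δ > 0. No cancellation in μ is used. -/
theorem tendsto_average_totient_div {δ : ℝ} (hδ : δ ∈ Set.Ioo (0 : ℝ) 1) :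
    Tendsto (fun X : ℝ => 1 / X ^ δ * ∑ N ∈ shortConductors X δ, (N.totient : ℝ) / N) atTop
      (𝓝 (5 / Real.pi ^ 2)) := by
  have hM : Tendsto (fun X : ℝ => ⌊X + X ^ δ⌋₊ + 1) atTop atTop := by
    refine tendsto_atTop_mono' _ ?_ tendsto_nat_floor_atTop
    filter_upwards [eventually_ge_atTop 0] with X hX
    have := Real.rpow_nonneg hX δ
    exact (Nat.floor_mono (by linarith)).trans (Nat.le_succ _)
  have hmain := hasSum_moebius_mul_multipleDensity.tendsto_sum_nat.comp hM
  have herr : Tendsto (fun X : ℝ => 3 * ((2 + Real.log 2) * (X ^ (-δ)) + Real.log X / X ^ δ))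
      atTop (𝓝 0) := by
    have h1 := (isLittleO_log_rpow_atTop hδ.1).tendsto_div_nhds_zero
    have h2 := (tendsto_rpow_neg_atTop hδ.1).const_mul (2 + Real.log 2)
    simpa using (h2.add h1).const_mul 3
  refine tendsto_of_tendsto_of_dist hmain ?_
  refine squeeze_zero' (Eventually.of_forall fun _ => dist_nonneg) ?_ herr
  filter_upwards [eventually_ge_atTop 1] with X hX
  have hX0 : 0 < X := by linarith
  have hL : 0 < X ^ δ := Real.rpow_pos_of_pos hX0 _
  have hLX : X ^ δ ≤ X := by
    simpa using Real.rpow_le_rpow_of_exponent_le hX hδ.2.le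
  set M := ⌊X + X ^ δ⌋₊ with hMdef
  have hM1 : 1 ≤ M := Nat.le_floor (by push_cast; linarith)
  have hM2 : (M : ℝ) ≤ 2 * X := (Nat.floor_le (by linarith)).trans (by linarith)
  have hH : ∑ d ∈ Finset.range (M + 1), 1 / (d : ℝ) ≤ 1 + Real.log M := by
    have h := harmonic_le_one_add_log M
    rw [harmonic_eq_sum_Icc] at h
    push_cast at h
    refine le_trans (le_of_eq ?_) h
    rw [Finset.range_eq_Ico, Finset.sum_eq_sum_Ico_succ_bot (by omega)]
    simp only [Nat.cast_zero, div_zero, zero_add, one_div]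
    rfl
  have hlogM : Real.log M ≤ Real.log 2 + Real.log X := by
    rw [← Real.log_mul (by norm_num) hX0.ne']
    exact Real.log_le_log (by exact_mod_cast hM1) hM2
  rw [Function.comp, dist_comm, Real.dist_eq, sum_totient_div_shortConductors hX0,
    Finset.mul_sum, ← Finset.sum_sub_distrib]
  calc _ ≤ ∑ d ∈ Finset.range (M + 1), 3 / X ^ δ * (1 / (d : ℝ)) := by
        refine (Finset.abs_sum_le_sum_abs _ _).trans (Finset.sum_le_sum fun d _ => ?_)
        rcases Nat.eq_zero_or_pos d with rfl | hd
        · simp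
        · have h1 := abs_card_shortConductors_dvd_sub_le (δ := δ) hX0 hd
          have hd0 : (0 : ℝ) < d := by exact_mod_cast hd
          have h2 : |(moebius d : ℝ)| ≤ 1 := by
            exact_mod_cast ArithmeticFunction.abs_moebius_le_one (n := d)
          set c : ℝ := (((shortConductors X δ).filter (d ∣ ·)).card : ℝ)
          have h3 : 1 / X ^ δ * ((moebius d : ℝ) / d * c) - (moebius d : ℝ) / d * multipleDensity d
              = (moebius d : ℝ) * (c - X ^ δ * multipleDensity d) * (1 / X ^ δ * (1 / d)) := by
            field_simp
          rw [h3, abs_mul, abs_mul, abs_of_pos (show 0 < 1 / X ^ δ * (1 / (d : ℝ)) by positivity)]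
          calc _ ≤ 1 * 3 * (1 / X ^ δ * (1 / (d : ℝ))) := by gcongr
            _ = _ := by ring
    _ = 3 / X ^ δ * ∑ d ∈ Finset.range (M + 1), 1 / (d : ℝ) := by rw [Finset.mul_sum]
    _ ≤ 3 / X ^ δ * (2 + Real.log 2 + Real.log X) := by gcongr; linarith
    _ = _ := by rw [Real.rpow_neg hX0.le]; field_simp

/-! ### Gauss sums and orthogonality -/

/-- For primitive χ the discrete Fourier transform is τ(χ) χ̄(−k). Transforming twice returns N
χ(−k); compare both at k = 1. -/
theorem tau_mul_tau_star {N : ℕ} [NeZero N] {χ : DirichletCharacter ℂ N} (hχ : χ.IsPrimitive) :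
    tau χ * tau (star χ) = χ (-1) * N := by
  have h1 : ZMod.dft (χ : ZMod N → ℂ) =
      fun k => gaussSum χ (ZMod.stdAddChar (N := N)) * χ⁻¹ (-k) := by
    ext k
    rw [hχ.fourierTransform_eq_inv_mul_gaussSum, mul_comm]
  have h2 := congrFun (ZMod.dft_dft (χ : ZMod N → ℂ)) 1
  have h3 := ZMod.dft_const_mul (gaussSum χ (ZMod.stdAddChar (N := N)))
    (fun k : ZMod N => χ⁻¹ (-k))
  rw [h1, h3, ZMod.dft_comp_neg] at h2
  simp only at h2
  rw [DirichletCharacter.fourierTransform_eq_gaussSum_mulShift, neg_neg, AddChar.mulShift_one,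
    smul_eq_mul] at h2
  rw [tau_eq_gaussSum, tau_eq_gaussSum, MulChar.star_eq_inv, h2, mul_comm]

theorem sum_divisors_moebius (n : ℕ) :
    ∑ d ∈ n.divisors, moebius d = if n = 1 then 1 else 0 := by
  rw [← ArithmeticFunction.coe_mul_zeta_apply, ArithmeticFunction.moebius_mul_coe_zeta,
    ArithmeticFunction.one_apply]

theorem sum_exp_two_pi_div {m : ℕ} (hm : 1 < m) :
    ∑ k ∈ Finset.Icc 1 m, Complex.exp (2 * Real.pi * Complex.I * k / m) = 0 := by
  have h := (Complex.isPrimitiveRoot_exp m (by omega)).geom_sum_eq_zero hm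
  have h1 : ∀ k : ℕ, Complex.exp (2 * Real.pi * Complex.I * k / m) =
      Complex.exp (2 * Real.pi * Complex.I / m) ^ k := by
    intro k
    rw [← Complex.exp_nat_mul]
    congr 1
    ring
  have h2 := (Complex.isPrimitiveRoot_exp m (by omega)).pow_eq_one
  simp only [h1]
  have h3 := Finset.sum_range_succ (fun k => Complex.exp (2 * Real.pi * Complex.I / m) ^ k) m
  rw [Finset.sum_range_succ', h, h2, pow_zero, zero_add, add_eq_right] at h3
  rw [← h3, Finset.range_eq_Ico, Finset.sum_Ico_add' (fun k =>
    Complex.exp (2 * Real.pi * Complex.I / m) ^ k) 0 m 1]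
  rfl

/-- A Ramanujan sum: detect coprimality by ∑ μ(d) over d dividing gcd(b, N). The multiples of d then
run over all (N/d)-th roots of unity, whose sum vanishes unless d = N. -/
theorem tau_one {N : ℕ} [NeZero N] : tau (1 : DirichletCharacter ℂ N) = moebius N := by
  have hN : 0 < N := Nat.pos_of_ne_zero (NeZero.ne N)
  have h1 : ∀ b ∈ Finset.Icc 1 N, (1 : DirichletCharacter ℂ N) (b : ZMod N) *
      Complex.exp (2 * Real.pi * Complex.I * b / N) =
      ∑ d ∈ N.divisors, if d ∣ b then
        (moebius d : ℂ) * Complex.exp (2 * Real.pi * Complex.I * b / N) else 0 := by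
    intro b hb
    have h2 : (1 : DirichletCharacter ℂ N) (b : ZMod N) =
        ((∑ d ∈ (b.gcd N).divisors, moebius d : ℤ) : ℂ) := by
      rw [sum_divisors_moebius]
      by_cases hc : b.Coprime N
      · rw [if_pos hc, MulChar.one_apply ((ZMod.isUnit_iff_coprime _ _).2 hc)]
        simp
      · rw [if_neg hc, MulChar.map_nonunit _ (mt (ZMod.isUnit_iff_coprime _ _).1 hc)]
        simp
    rw [h2, ← Finset.sum_filter, ← Finset.sum_mul]
    push_cast
    congr 1
    refine Finset.sum_congr ?_ fun _ _ => rfl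
    ext d
    simp only [Nat.mem_divisors, Finset.mem_filter, Nat.dvd_gcd_iff, ne_eq, Nat.gcd_eq_zero_iff, hN.ne']
    tauto
  rw [tau, Finset.sum_congr rfl h1, Finset.sum_comm]
  have h3 : ∀ d ∈ N.divisors, (∑ b ∈ Finset.Icc 1 N, if d ∣ b then
        (moebius d : ℂ) * Complex.exp (2 * Real.pi * Complex.I * b / N) else 0) =
      if d = N then (moebius N : ℂ) else 0 := by
    intro d hd
    have hd0 := Nat.pos_of_mem_divisors hd
    obtain ⟨m, rfl⟩ := Nat.dvd_of_mem_divisors hd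
    have hm0 : 0 < m := Nat.pos_of_mul_pos_left hN
    have himg : (Finset.Icc 1 (d * m)).filter (d ∣ ·) = (Finset.Icc 1 m).image (d * ·) := by
      ext n
      simp only [Finset.mem_filter, Finset.mem_Icc, Finset.mem_image]
      constructor
      · rintro ⟨⟨h1, h2⟩, k, rfl⟩
        exact ⟨k, ⟨Nat.pos_of_mul_pos_left h1, Nat.le_of_mul_le_mul_left h2 hd0⟩, rfl⟩
      · rintro ⟨k, ⟨h1, h2⟩, rfl⟩
        exact ⟨⟨Nat.mul_pos hd0 h1, Nat.mul_le_mul_left _ h2⟩, dvd_mul_right _ _⟩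
    rw [← Finset.sum_filter, ← Finset.mul_sum, himg,
      Finset.sum_image fun x _ y _ h => Nat.eq_of_mul_eq_mul_left hd0 h]
    have hdc : (d : ℂ) ≠ 0 := by exact_mod_cast hd0.ne'
    have hmc : (m : ℂ) ≠ 0 := by exact_mod_cast hm0.ne'
    have h4 : ∀ k : ℕ, 2 * Real.pi * Complex.I * (d * k : ℕ) / (d * m : ℕ) =
        2 * Real.pi * Complex.I * k / m := by
      intro k
      push_cast
      field_simp
    simp only [h4]
    rcases Nat.lt_or_ge 1 m with hm | hm
    · rw [sum_exp_two_pi_div hm, if_neg, mul_zero]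
      intro h
      have : d * 1 < d * m := Nat.mul_lt_mul_of_pos_left hm hd0
      omega
    · obtain rfl : m = 1 := by omega
      simp [Complex.exp_two_pi_mul_I]
  rw [Finset.sum_congr rfl h3, Finset.sum_ite_eq' N.divisors N, if_pos (by simp [hN.ne'])]

theorem norm_tau_one_le {N : ℕ} [NeZero N] : ‖tau (1 : DirichletCharacter ℂ N)‖ ≤ 1 := by
  rw [tau_one, Complex.norm_intCast]
  exact_mod_cast ArithmeticFunction.abs_moebius_le_one (n := N)

/-- `ε (e(t) + ε e(-t)) / 2`, which is `cos (2πt)` for `ε = 1` and `-i sin (2πt)` for `ε = -1`. -/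
def wave (ε : ℤˣ) (t : ℝ) : ℂ :=
  ((ε : ℤ) : ℂ) * ((Complex.exp (2 * Real.pi * Complex.I * t) +
    ((ε : ℤ) : ℂ) * Complex.exp (2 * Real.pi * Complex.I * (-t))) / 2)

theorem wave_one (t : ℝ) : wave 1 t = (Real.cos (2 * Real.pi * t) : ℝ) := by
  rw [wave, Complex.ofReal_cos, Complex.cos]
  push_cast
  rw [one_mul, one_mul]
  congr 3 <;> ring

theorem wave_neg_one (t : ℝ) :
    wave (-1) t = -Complex.I * (Real.sin (2 * Real.pi * t) : ℝ) := by
  have h1 : 2 * Real.pi * Complex.I * t = (2 * Real.pi * t) * Complex.I := by ring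
  have h2 : 2 * Real.pi * Complex.I * (-t) = -(2 * Real.pi * t) * Complex.I := by ring
  rw [wave, Complex.ofReal_sin, Complex.sin, h1, h2]
  push_cast
  linear_combination ((1 : ℂ) / 2) * (Complex.exp (-(2 * Real.pi * t) * Complex.I) -
    Complex.exp ((2 * Real.pi * t) * Complex.I)) * Complex.I_sq

theorem norm_wave_le (ε : ℤˣ) (t : ℝ) : ‖wave ε t‖ ≤ 1 := by
  rcases Int.units_eq_one_or ε with rfl | rfl
  · rw [wave_one, Complex.norm_real]
    exact Real.abs_cos_le_one _
  · rw [wave_neg_one, norm_mul, norm_neg, Complex.norm_I, one_mul, Complex.norm_real]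
    exact Real.abs_sin_le_one _

theorem norm_wave_sub_le (ε : ℤˣ) (s t : ℝ) :
    ‖wave ε s - wave ε t‖ ≤ 2 * Real.pi * |s - t| := by
  have h : 2 * Real.pi * |s - t| = |2 * Real.pi * s - 2 * Real.pi * t| := by
    rw [← mul_sub, abs_mul, abs_of_pos (by positivity : 0 < 2 * Real.pi)]
  rw [h]
  rcases Int.units_eq_one_or ε with rfl | rfl
  · rw [wave_one, wave_one, ← Complex.ofReal_sub, Complex.norm_real]
    exact Real.abs_cos_sub_cos_le _ _
  · rw [wave_neg_one, wave_neg_one, ← mul_sub, norm_mul, norm_neg, Complex.norm_I, one_mul,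
      ← Complex.ofReal_sub, Complex.norm_real]
    exact Real.abs_sin_sub_sin_le _ _

open Classical in
/-- Orthogonality of characters of a given parity, against Gauss sums. -/
theorem sum_tau_star_mul {N : ℕ} [NeZero N] (ε : ℤˣ) {p : ℕ} (hp : p.Coprime N) :
    ((ε : ℤ) : ℂ) * ∑ χ : DirichletCharacter ℂ N with χ (-1) = ((ε : ℤ) : ℂ),
      tau (star χ) * χ (p : ZMod N) = N.totient * wave ε (p / N) := by
  have hu : IsUnit (p : ZMod N) := (ZMod.isUnit_iff_coprime _ _).2 hp
  have hinv : ∀ χ : DirichletCharacter ℂ N, χ⁻¹ (p : ZMod N) = χ (p : ZMod N)⁻¹ := by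
    intro χ
    rw [MulChar.inv_apply]
    congr 1
    obtain ⟨u, hu⟩ := hu
    rw [← hu, Ring.inverse_unit, ZMod.inv_coe_unit]
  have hneg : ∀ χ : DirichletCharacter ℂ N, χ⁻¹ (-1) = χ (-1) := by
    intro χ
    rw [MulChar.inv_apply]
    congr 1
    have := Ring.inverse_unit (-1 : (ZMod N)ˣ)
    simpa using this
  have hε : ((ε : ℤ) : ℂ) = 1 ∨ ((ε : ℤ) : ℂ) = -1 := by
    rcases Int.units_eq_one_or ε with rfl | rfl <;> simp
  -- Replace the parity condition by the projector (1 + εχ(−1))/2, and reindex by χ ↦ χ̄.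
  have h1 : ∑ χ : DirichletCharacter ℂ N with χ (-1) = ((ε : ℤ) : ℂ),
      tau (star χ) * χ (p : ZMod N) =
      ∑ χ : DirichletCharacter ℂ N, (1 + ((ε : ℤ) : ℂ) * χ (-1)) / 2 *
        (tau χ * χ (p : ZMod N)⁻¹) := by
    rw [Finset.sum_filter, ← Equiv.sum_comp (Equiv.inv (DirichletCharacter ℂ N))]
    refine Finset.sum_congr rfl fun χ _ => ?_
    simp only [Equiv.inv_apply, MulChar.star_eq_inv, inv_inv, hneg, hinv]
    have hχ : χ (-1) = 1 ∨ χ (-1) = -1 := by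
      rcases χ.even_or_odd with h | h
      · exact Or.inl h
      · exact Or.inr h
    rcases hε with h | h <;> rcases hχ with h' | h' <;> rw [h, h'] <;> norm_num
  have h2 : ∀ χ : DirichletCharacter ℂ N, (1 + ((ε : ℤ) : ℂ) * χ (-1)) / 2 *
        (tau χ * χ (p : ZMod N)⁻¹) = ∑ b : ZMod N, ZMod.stdAddChar b / 2 *
          (χ (p : ZMod N)⁻¹ * χ b + ((ε : ℤ) : ℂ) * (χ (p : ZMod N)⁻¹ * χ (-b))) := by
    intro χ
    rw [tau_eq_gaussSum, gaussSum, Finset.sum_mul, Finset.mul_sum]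
    refine Finset.sum_congr rfl fun b _ => ?_
    rw [← neg_one_mul b, map_mul]
    ring
  have h3 : ∀ b : ZMod N, ∑ χ : DirichletCharacter ℂ N, ZMod.stdAddChar b / 2 *
      (χ (p : ZMod N)⁻¹ * χ b + ((ε : ℤ) : ℂ) * (χ (p : ZMod N)⁻¹ * χ (-b))) =
      (if (p : ZMod N) = b then ZMod.stdAddChar b / 2 * (N.totient : ℂ) else 0) +
      (if -(p : ZMod N) = b then
        ZMod.stdAddChar b / 2 * (((ε : ℤ) : ℂ) * (N.totient : ℂ)) else 0) := by
    intro b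
    rw [← Finset.mul_sum, Finset.sum_add_distrib, ← Finset.mul_sum,
      DirichletCharacter.sum_char_inv_mul_char_eq ℂ hu,
      DirichletCharacter.sum_char_inv_mul_char_eq ℂ hu]
    have : (p : ZMod N) = -b ↔ -(p : ZMod N) = b := neg_eq_iff_eq_neg.symm
    simp only [this]
    split_ifs <;> ring
  have h4 := ZMod.stdAddChar_coe (N := N) (p : ℤ)
  have h5 := ZMod.stdAddChar_coe (N := N) (-p : ℤ)
  push_cast at h4 h5
  have h6 : (2 * Real.pi * Complex.I * ((p / N : ℝ) : ℂ)) = 2 * Real.pi * Complex.I * p / N := by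
    push_cast; ring
  have h7 : (2 * Real.pi * Complex.I * -((p / N : ℝ) : ℂ)) =
      2 * Real.pi * Complex.I * (-p) / N := by
    push_cast; ring
  rw [h1, Finset.sum_congr rfl fun χ _ => h2 χ, Finset.sum_comm, Finset.sum_congr rfl fun b _ =>
    h3 b, Finset.sum_add_distrib, Finset.sum_ite_eq, Finset.sum_ite_eq, if_pos (Finset.mem_univ _),
    if_pos (Finset.mem_univ _), h4, h5, wave, h6, h7]
  ring

/-! ### The contribution of one modulus -/

/-- The contribution of the modulus `N` to `T̃_ε`, evaluated at the prime `p`. -/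
def modulusTerm (ε : ℤˣ) (N p : ℕ) : ℂ :=
  ∑ χ ∈ primitiveChars ε N, χ (p : ZMod N) / tau χ +
    ((ε : ℤ) : ℂ) * (1 / (N : ℂ) * ∑ χ ∈ imprimitiveChars ε N, tau (star χ) * χ (p : ZMod N))

open Classical in
/-- The non-principal Dirichlet characters `χ` mod `N` with `χ(-1) = ε`. -/
def nonprincipalChars (ε : ℤˣ) (N : ℕ) : Finset (DirichletCharacter ℂ N) :=
  Finset.univ.filter fun χ => χ ≠ 1 ∧ χ (-1) = ((ε : ℤ) : ℂ)

theorem mem_nonprincipalChars {ε : ℤˣ} {N : ℕ} {χ : DirichletCharacter ℂ N} :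
    χ ∈ nonprincipalChars ε N ↔ χ ≠ 1 ∧ χ (-1) = ((ε : ℤ) : ℂ) := by
  simp [nonprincipalChars]

theorem mem_primitiveChars {ε : ℤˣ} {N : ℕ} {χ : DirichletCharacter ℂ N} :
    χ ∈ primitiveChars ε N ↔ χ.IsPrimitive ∧ χ (-1) = ((ε : ℤ) : ℂ) := by
  simp [primitiveChars]

theorem mem_imprimitiveChars {ε : ℤˣ} {N : ℕ} {χ : DirichletCharacter ℂ N} :
    χ ∈ imprimitiveChars ε N ↔ ¬ χ.IsPrimitive ∧ χ ≠ 1 ∧ χ (-1) = ((ε : ℤ) : ℂ) := by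
  simp [imprimitiveChars]

/-- The product formula turns 1/τ(χ) into ε τ(χ̄)/N, the shape of the imprimitive terms. N = 1 must
be excluded because there the principal character is primitive. -/
theorem modulusTerm_eq {N : ℕ} (hN : 2 ≤ N) (ε : ℤˣ) (p : ℕ) :
    modulusTerm ε N p = 1 / (N : ℂ) * (((ε : ℤ) : ℂ) *
      ∑ χ ∈ nonprincipalChars ε N, tau (star χ) * χ (p : ZMod N)) := by
  classical
  have : NeZero N := ⟨by omega⟩
  have hN0 : (N : ℂ) ≠ 0 := by exact_mod_cast NeZero.ne N
  have hεε : ((ε : ℤ) : ℂ) * ((ε : ℤ) : ℂ) = 1 := by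
    rcases Int.units_eq_one_or ε with rfl | rfl <;> simp
  have h1 : ∑ χ ∈ primitiveChars ε N, χ (p : ZMod N) / tau χ =
      ((ε : ℤ) : ℂ) * (1 / (N : ℂ) * ∑ χ ∈ primitiveChars ε N,
        tau (star χ) * χ (p : ZMod N)) := by
    rw [Finset.mul_sum, Finset.mul_sum]
    refine Finset.sum_congr rfl fun χ hχ => ?_
    rw [mem_primitiveChars] at hχ
    have h2 := tau_mul_tau_star hχ.1
    rw [hχ.2] at h2
    have h3 : tau χ ≠ 0 := by
      intro h0
      rw [h0, zero_mul] at h2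
      have : ((ε : ℤ) : ℂ) * (((ε : ℤ) : ℂ) * N) = 0 := by rw [← h2, mul_zero]
      rw [← mul_assoc, hεε, one_mul] at this
      exact hN0 this
    rw [div_eq_iff h3]
    field_simp
    linear_combination (-(((ε : ℤ) : ℂ)) * χ (p : ZMod N)) * h2 - χ (p : ZMod N) * N * hεε
  have hdisj : Disjoint (primitiveChars ε N) (imprimitiveChars ε N) := by
    rw [Finset.disjoint_left]
    intro χ h h'
    exact (mem_imprimitiveChars.1 h').1 (mem_primitiveChars.1 h).1
  have hunion : nonprincipalChars ε N = primitiveChars ε N ∪ imprimitiveChars ε N := by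
    ext χ
    rw [Finset.mem_union, mem_nonprincipalChars, mem_primitiveChars, mem_imprimitiveChars]
    have h0 : χ.IsPrimitive → χ ≠ 1 := by
      rintro h rfl
      rw [DirichletCharacter.isPrimitive_def, DirichletCharacter.conductor_one] at h
      omega
    tauto
  rw [modulusTerm, h1, hunion, Finset.sum_union hdisj]
  ring

/-- If p ∤ N, the only discrepancy with full orthogonality is the principal character, whose Gauss
sum μ(N) is bounded by 1. If p ∣ N, every χ(p) vanishes and the main term itself, at most 1, is the
error. -/
theorem norm_modulusTerm_sub_le {N : ℕ} (hN : 2 ≤ N) (ε : ℤˣ) {p : ℕ} (hp : p.Prime) :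
    ‖modulusTerm ε N p - ((N.totient : ℝ) / N : ℝ) * wave ε (p / N)‖ ≤
      1 / N + if p ∣ N then 1 else 0 := by
  classical
  have : NeZero N := ⟨by omega⟩
  have hN0 : (0 : ℝ) < N := by positivity
  rw [modulusTerm_eq hN]
  split_ifs with hpN
  · have h1 : ¬ IsUnit (p : ZMod N) := by
      rw [ZMod.isUnit_iff_coprime, hp.coprime_iff_not_dvd]
      exact not_not.2 hpN
    have h2 : ∑ χ ∈ nonprincipalChars ε N,
        tau (star χ) * χ (p : ZMod N) = 0 :=
      Finset.sum_eq_zero fun χ _ => by rw [MulChar.map_nonunit _ h1, mul_zero]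
    rw [h2, mul_zero, mul_zero, zero_sub, norm_neg, norm_mul, Complex.norm_real,
      Real.norm_of_nonneg (by positivity)]
    have h3 : (N.totient : ℝ) / N ≤ 1 := by
      rw [div_le_one hN0]
      exact_mod_cast Nat.totient_le N
    have h4 := mul_le_one₀ h3 (norm_nonneg _) (norm_wave_le ε (p / N))
    have : (0 : ℝ) < 1 / N := by positivity
    linarith
  · have hc : p.Coprime N := (hp.coprime_iff_not_dvd).2 hpN
    have hsplit : ∑ χ : DirichletCharacter ℂ N with χ (-1) = ((ε : ℤ) : ℂ),
          tau (star χ) * χ (p : ZMod N) =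
        (∑ χ ∈ nonprincipalChars ε N,
          tau (star χ) * χ (p : ZMod N)) +
        if (1 : DirichletCharacter ℂ N) (-1) = ((ε : ℤ) : ℂ) then
          tau (star (1 : DirichletCharacter ℂ N)) * (1 : DirichletCharacter ℂ N) (p : ZMod N)
        else 0 := by
      split_ifs with h
      · rw [← Finset.sum_erase_add (Finset.univ.filter fun χ : DirichletCharacter ℂ N =>
          χ (-1) = ((ε : ℤ) : ℂ)) _ (a := 1) ((Finset.mem_filter_univ _).2 h)]
        congr 1
        refine Finset.sum_congr ?_ fun _ _ => rfl
        ext χ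
        rw [Finset.mem_erase, mem_nonprincipalChars, Finset.mem_filter_univ]
      · rw [add_zero]
        refine Finset.sum_congr ?_ fun _ _ => rfl
        ext χ
        rw [mem_nonprincipalChars, Finset.mem_filter_univ]
        exact ⟨fun h' => ⟨by rintro rfl; exact h h', h'⟩, fun h' => h'.2⟩
    have hmain := sum_tau_star_mul ε hc
    rw [hsplit, mul_add] at hmain
    have hbound : ‖(if (1 : DirichletCharacter ℂ N) (-1) = ((ε : ℤ) : ℂ) then
          tau (star (1 : DirichletCharacter ℂ N)) * (1 : DirichletCharacter ℂ N) (p : ZMod N)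
        else 0)‖ ≤ 1 := by
      split_ifs
      · rw [MulChar.star_eq_inv, inv_one, norm_mul]
        exact mul_le_one₀ norm_tau_one_le (norm_nonneg _)
          (DirichletCharacter.norm_le_one _ _)
      · simp
    set E := (if (1 : DirichletCharacter ℂ N) (-1) = ((ε : ℤ) : ℂ) then
          tau (star (1 : DirichletCharacter ℂ N)) * (1 : DirichletCharacter ℂ N) (p : ZMod N)
        else 0)
    have heq : 1 / (N : ℂ) * (((ε : ℤ) : ℂ) *
      ∑ χ ∈ nonprincipalChars ε N,
        tau (star χ) * χ (p : ZMod N)) - ((N.totient : ℝ) / N : ℝ) * wave ε (p / N) =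
        -(1 / (N : ℂ) * (((ε : ℤ) : ℂ) * E)) := by
      push_cast
      linear_combination (1 / (N : ℂ)) * hmain
    have hε1 : ‖((ε : ℤ) : ℂ)‖ = 1 := by
      rcases Int.units_eq_one_or ε with rfl | rfl <;> simp
    rw [heq, norm_neg, norm_mul, norm_mul, hε1, one_mul, norm_div, norm_one, Complex.norm_natCast,
      add_zero]
    exact mul_le_of_le_one_right (by positivity) hbound

/-! ### Averaging over moduli and the limit -/

theorem Ttilde_eq (ε : ℤˣ) (y X δ : ℝ) :
    Ttilde ε y X δ = ((1 / X ^ δ : ℝ) : ℂ) *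
      ∑ N ∈ shortConductors X δ, modulusTerm ε N (primeCeil (y * X)) := by
  simp only [Ttilde, Qtilde, Etilde, modulusTerm]
  rw [Finset.sum_add_distrib, ← Finset.mul_sum]
  push_cast
  ring

theorem mem_shortConductors_bounds {X δ : ℝ} (hX : 0 < X) {N : ℕ} (hN : N ∈ shortConductors X δ) :
    X ≤ N ∧ (N : ℝ) ≤ X + X ^ δ := by
  rw [shortConductors, Finset.mem_filter, Finset.mem_Icc] at hN
  have := Real.rpow_nonneg hX.le δ
  exact ⟨Nat.ceil_le.1 hN.1.1, (Nat.le_floor_iff (by linarith)).1 hN.1.2⟩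

theorem card_shortConductors_filter_dvd_le {X δ : ℝ} (hX : 0 < X) {m : ℕ} (hm : 0 < m) :
    (((shortConductors X δ).filter (m ∣ ·)).card : ℝ) ≤ X ^ δ * (1 / m) + 1 := by
  have h0 := Real.rpow_nonneg hX.le δ
  have h1 := abs_card_filter_dvd_sub_le (b := X + X ^ δ) hX (by linarith) hm
  rw [add_sub_cancel_left, abs_le] at h1
  have h2 : (((shortConductors X δ).filter (m ∣ ·)).card : ℝ) ≤
      (((Finset.Icc ⌈X⌉₊ ⌊X + X ^ δ⌋₊).filter (m ∣ ·)).card : ℝ) := by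
    exact_mod_cast Finset.card_le_card (Finset.filter_subset_filter _ (Finset.filter_subset _ _))
  linarith

/-- The factor 1 + X^{-δ} bounds the number of moduli over X^δ. It multiplies the
principal-character error and the Lipschitz cost of replacing p/N by y. The last bracket counts the
moduli divisible by p, using p ≥ yX. -/
theorem norm_Ttilde_sub_le (ε : ℤˣ) {y X δ : ℝ} (hy : 0 < y) (hX : 2 ≤ X) :
    ‖Ttilde ε y X δ - ((1 / X ^ δ * ∑ N ∈ shortConductors X δ, (N.totient : ℝ) / N : ℝ) : ℂ) *
        wave ε y‖ ≤
      (1 + X ^ (-δ)) * (1 / X + 2 * Real.pi *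
        (primeCeil (y * X) / X * (X ^ δ / X) + |primeCeil (y * X) / X - y|)) +
      (1 / (y * X) + X ^ (-δ)) := by
  have hX0 : 0 < X := by linarith
  have hL : 0 < X ^ δ := Real.rpow_pos_of_pos hX0 _
  obtain ⟨hp, hpy⟩ := le_primeCeil (y * X)
  set p := primeCeil (y * X)
  have hp0 : (0 : ℝ) < p := by exact_mod_cast hp.pos
  set r : ℝ := p / X * (X ^ δ / X) + |p / X - y| with hr
  have hr0 : 0 ≤ r := by positivity
  have hterm : ∀ N ∈ shortConductors X δ,
      ‖modulusTerm ε N p - ((N.totient : ℝ) / N : ℝ) * wave ε y‖ ≤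
        (1 / X + 2 * Real.pi * r) + if p ∣ N then 1 else 0 := by
    intro N hN
    obtain ⟨h1, h2⟩ := mem_shortConductors_bounds hX0 hN
    have hN0 : (0 : ℝ) < N := by linarith
    have hN2 : 2 ≤ N := by exact_mod_cast hX.trans h1
    have h3 := norm_modulusTerm_sub_le hN2 ε hp
    -- Pass through p/X: the move from N to X costs (p/X)(N − X)/N, with N − X ≤ X^δ and N ≥ X.
    have h4 : |(p : ℝ) / N - y| ≤ r := by
      have h5 : (p : ℝ) / N - y = -(p / X * ((N - X) / N)) + (p / X - y) := by
        field_simp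
        ring
      rw [h5]
      refine (abs_add_le _ _).trans (add_le_add_left ?_ _)
      rw [abs_neg, abs_of_nonneg (mul_nonneg (by positivity) (div_nonneg (by linarith) hN0.le))]
      gcongr
      linarith
    have h6 : (N.totient : ℝ) / N ≤ 1 := by
      rw [div_le_one hN0]
      exact_mod_cast Nat.totient_le N
    have h7 : ‖(((N.totient : ℝ) / N : ℝ) : ℂ) * (wave ε (p / N) - wave ε y)‖ ≤
        2 * Real.pi * r := by
      rw [norm_mul, Complex.norm_real, Real.norm_of_nonneg (by positivity)]
      refine (mul_le_of_le_one_left (norm_nonneg _) h6).trans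
        ((norm_wave_sub_le _ _ _).trans ?_)
      gcongr
    have h8 : (1 : ℝ) / N ≤ 1 / X := by gcongr
    calc _ = ‖(modulusTerm ε N p - ((N.totient : ℝ) / N : ℝ) * wave ε (p / N)) +
          (((N.totient : ℝ) / N : ℝ) : ℂ) * (wave ε (p / N) - wave ε y)‖ := by
          congr 1; ring
      _ ≤ _ := (norm_add_le _ _).trans (by linarith)
  have hcard1 : ((shortConductors X δ).card : ℝ) ≤ X ^ δ + 1 := by
    simpa using card_shortConductors_filter_dvd_le (δ := δ) hX0 one_pos
  have hcardp : (((shortConductors X δ).filter (p ∣ ·)).card : ℝ) ≤ X ^ δ * (1 / (y * X)) + 1 := by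
    refine (card_shortConductors_filter_dvd_le (δ := δ) hX0 hp.pos).trans ?_
    gcongr
  have heq : Ttilde ε y X δ -
      ((1 / X ^ δ * ∑ N ∈ shortConductors X δ, (N.totient : ℝ) / N : ℝ) : ℂ) * wave ε y =
      ((1 / X ^ δ : ℝ) : ℂ) * ∑ N ∈ shortConductors X δ,
        (modulusTerm ε N p - ((N.totient : ℝ) / N : ℝ) * wave ε y) := by
    rw [Ttilde_eq, Finset.sum_sub_distrib, ← Finset.sum_mul]
    push_cast
    ring
  rw [heq, norm_mul, Complex.norm_real, Real.norm_of_nonneg (by positivity)]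
  calc _ ≤ 1 / X ^ δ * ∑ N ∈ shortConductors X δ,
          ((1 / X + 2 * Real.pi * r) + if p ∣ N then 1 else 0) := by
        gcongr
        exact norm_sum_le_of_le _ hterm
    _ = 1 / X ^ δ * ((shortConductors X δ).card * (1 / X + 2 * Real.pi * r) +
          ((shortConductors X δ).filter (p ∣ ·)).card) := by
        rw [Finset.sum_add_distrib, Finset.sum_const, nsmul_eq_mul, Finset.sum_boole]
    _ ≤ 1 / X ^ δ * ((X ^ δ + 1) * (1 / X + 2 * Real.pi * r) +
          (X ^ δ * (1 / (y * X)) + 1)) := by gcongr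
    _ = _ := by
        rw [Real.rpow_neg hX0.le]
        field_simp

theorem tendsto_Ttilde (ε : ℤˣ) {δ : ℝ} (hδ : δ ∈ Set.Ioo (0 : ℝ) 1) {y : ℝ} (hy : 0 < y) :
    Tendsto (fun X : ℝ => Ttilde ε y X δ) atTop
      (𝓝 (((5 / Real.pi ^ 2 : ℝ) : ℂ) * wave ε y)) := by
  have hmain := ((Complex.continuous_ofReal.tendsto _).comp
    (tendsto_average_totient_div hδ)).mul_const (wave ε y)
  have hyX : Tendsto (fun X : ℝ => y * X) atTop atTop := tendsto_id.const_mul_atTop hy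
  have hq : Tendsto (fun X : ℝ => (primeCeil (y * X) : ℝ) / X) atTop (𝓝 y) := by
    have h := (tendsto_primeCeil_div.comp hyX).const_mul y
    rw [mul_one] at h
    refine h.congr' ?_
    filter_upwards [eventually_gt_atTop 0] with X hX
    simp only [Function.comp]
    field_simp
  have hneg : Tendsto (fun X : ℝ => X ^ (-δ)) atTop (𝓝 0) := tendsto_rpow_neg_atTop hδ.1
  have hsub : Tendsto (fun X : ℝ => X ^ δ / X) atTop (𝓝 0) := by
    refine (tendsto_rpow_neg_atTop (show 0 < 1 - δ by linarith [hδ.2])).congr' ?_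
    filter_upwards [eventually_gt_atTop 0] with X hX
    rw [neg_sub, Real.rpow_sub hX, Real.rpow_one]
  have hinv : Tendsto (fun X : ℝ => 1 / X) atTop (𝓝 0) := by
    simpa using tendsto_inv_atTop_zero
  have hinvy : Tendsto (fun X : ℝ => 1 / (y * X)) atTop (𝓝 0) := hinv.comp hyX
  have herr := (((hneg.const_add 1).mul (hinv.add (((hq.mul hsub).add
    (hq.sub_const y).abs).const_mul (2 * Real.pi)))).add (hinvy.add hneg))
  simp only [sub_self, abs_zero, mul_zero, add_zero] at herr
  refine tendsto_of_tendsto_of_dist hmain ?_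
  refine squeeze_zero' (Eventually.of_forall fun _ => dist_nonneg) ?_ herr
  filter_upwards [eventually_ge_atTop 2] with X hX
  rw [dist_comm, dist_eq_norm]
  exact norm_Ttilde_sub_le ε hy hX

end Murmuration

end

theorem mainTheorem5 (δ : ℝ) (hδ : δ ∈ Set.Ioo (0 : ℝ) 1) (y : ℝ) (hy : 0 < y) :
    Tendsto (fun X : ℝ => Murmuration.Ttilde 1 y X δ) atTop
      (𝓝 (((5 / Real.pi ^ 2 * Real.cos (2 * Real.pi * y) : ℝ) : ℂ))) ∧
    Tendsto (fun X : ℝ => Murmuration.Ttilde (-1) y X δ) atTop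
      (𝓝 (-Complex.I * ((5 / Real.pi ^ 2 * Real.sin (2 * Real.pi * y) : ℝ) : ℂ))) := by
  have h1 := Murmuration.tendsto_Ttilde 1 hδ hy
  have h2 := Murmuration.tendsto_Ttilde (-1) hδ hy
  rw [Murmuration.wave_one, ← Complex.ofReal_mul] at h1
  rw [Murmuration.wave_neg_one, mul_left_comm, ← Complex.ofReal_mul] at h2
  exact ⟨h1, h2⟩
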